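/- Let $M\ge 1$, let $Q=(q_{ij})_{1\le i,j\le M}$ be a generator matrix ($q_{ij}\ge 0$ for $i\ne j$, zero row sums), let $\mu^i\ge 0$ and let $\phi^i$ be measurable kernels, non-negative on $[0,\infty)$, $1\le i\le M$; let $\delta>0$. Let $(S,N)$ be a Markov-modulated Hawkes process with $\delta$-piecewise constant kernel (MMHP-$\delta$) on a probability space: $S=(S_t)_{t\ge0}$ is a right-continuous continuous-time Markov chain on $\{1,\dots,M\}$ with generator $Q$ relative to the joint history of $(S,N)$, and $N=(N_t)_{t\ge 0}$ is a simple counting process with $N_0=0$ and occurrence times $0<t_1<t_2<\cdots$ (put $t_0=0$) which, given the whole path of $S$ (that is, in the filtration $\sigma(S_s,s\ge0)\vee\sigma(N_s,s\le t)$), has the stochastic intensity $$\lambda_t=\sum_{i=1}^M \mathbf 1_{\{S_t=i\}}\lambda^i_t,\qquad \lambda_t^i=\mu^i+\sum_{k\ge1,\;t_k<t}\phi^i\big(\omega(t)+\ell(t)\delta-t_k\big),$$ where $\omega(t)$ is the last occurrence time in $[0,t]$ ($\omega(t)=0$ if there is none) and $\ell(t)=\max\{l\in\mathbb N:\omega(t)+l\delta\le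 t\}$. Let $\mathcal F_t=\sigma(N_s,0\le s\le t)$. Fix $n\ge1$. For $k\ge0$ let $\Lambda^{(n)}_k$ be the diagonal matrix with entries $\mu^i+\sum_{l=1}^{n-1}\phi^i(t_{n-1}+k\delta-t_l)$, $1\le i\le M$ (the intensities on the $k$-th $\delta$-step after $t_{n-1}$, before the next event), and put, with factors in increasing order of $r$ from left to right and empty products equal to the identity, $$\Xi^{(n)}_k=\prod_{r=1}^{k}e^{(Q-\Lambda^{(n)}_{r-1})\delta}.$$ **Forward.** Let $H^{(n)}_{ij}(u)=\mathbb P\big(S_{t_{n-1}+u}=j,\;N_{t_{n-1}+u}-N_{t_{n-1}}=0\;\big|\;S_{t_{n-1}}=i,\mathcal F_{t_{n-1}}\big)$, that is, the value on $\{t_{n-1}<\infty,\,S_{t_{n-1}}=i\}$ of the conditional probability given $\sigma(S_{t_{n-1}})\vee\mathcal F_{t_{n-1}}$. Then for every $u\ge 0$ and all $i,j$, with $k=\lfloor u/\delta\rfloor$, almost surely on this event, $$H^{(n)}_{ij}(u)=\Big(\Xi^{(n)}_{k}\,e^{(Q-\Lambda^{(n)}_{k})(u-k\delta)}\Big)_{ij}.$$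 **Backward.** Let $x_n>0$ be a value of the duration, $t_n=t_{n-1}+x_n$, let $\ell_n$ be the largest $l\in\mathbb N$ with $l\delta<x_n$, $\Delta_n=x_n-\ell_n\delta\in(0,\delta]$, and $$\Psi^{(n)}_k=\prod_{r=1}^{k}e^{(Q-\Lambda^{(n)}_{\ell_n-(k-r)-1})\delta},\qquad 0\le k\le\ell_n.$$ For $u\in[0,x_n]$ let $G^{(n)}_{ij}(u)=\mathbb P\big(S_{t_n}=j,\;N_{t_n}-N_{t_n-u}=0\;\big|\;S_{t_n-u}=i,\mathcal F_{t_n-u}\big)$, that is, the value of the conditional probability given $\sigma(S_{t_n-u})\vee\mathcal F_{t_n-u}$ on the event that $t_{n-1}<\infty$, $S_{t_n-u}=i$ and no event has occurred in $(t_{n-1},t_n-u]$. Then for all $i,j$, with $m=\lfloor (x_n-u)/\delta\rfloor$, almost surely on this event, $G^{(n)}_{ij}(u)$ is the $(i,j)$ entry of $$\begin{cases} e^{(Q-\Lambda^{(n)}_{\ell_n})u} & \text{if } u\le\Delta_n,\\[1ex] e^{(Q-\Lambda^{(n)}_{m})\left(u-((\ell_n-m-1)\delta+\Delta_n)\right)}\;\Psi^{(n)}_{\ell_n-m-1}\;e^{(Q-\Lambda^{(n)}_{\ell_n})\Delta_n}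 & \text{otherwise.}\end{cases}$$ -/

import Mathlib

open MeasureTheory
open scoped NNReal ENNReal

namespace MMHP

section Paths

variable {Ω : Type*}

/-- Paths of a simple counting process `N` on `[0, ∞)`: `N` starts from `0`, is non-decreasing and
right-continuous, and has only jumps of size one. -/
structure IsCountingProcess (N : ℝ≥0 → Ω → ℕ) : Prop where
  zero : ∀ ω, N 0 ω = 0
  mono : ∀ ω, Monotone fun t => N t ω
  rightCts : ∀ ω t, ContinuousWithinAt (fun s => N s ω) (Set.Ici t) t
  unit_jumps : ∀ ω t, 0 < t → ∃ s < t, N t ω ≤ N s ω + 1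

/-- The `k`-th occurrence time `t_k` as a number, `t_k = inf {t : k ≤ N_t}`; in particular `t_0 = 0`.
It is meaningful only on the event that `k` is reached, see `eventTime`. -/
noncomputable def arrival (N : ℝ≥0 → Ω → ℕ) (k : ℕ) (ω : Ω) : ℝ≥0 :=
  sInf {t : ℝ≥0 | k ≤ N t ω}

open Classical in
/-- The `k`-th occurrence time `t_k ∈ [0, ∞]`, equal to `⊤` if fewer than `k` events ever occur. -/
noncomputable def eventTime (N : ℝ≥0 → Ω → ℕ) (k : ℕ) (ω : Ω) : WithTop ℝ≥0 :=
  if ∃ t, k ≤ N t ω then (arrival N k ω : WithTop ℝ≥0) else ⊤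

/-- `ω(t)`, the last occurrence time before or at `t` (`t_0 = 0` if there is none). -/
noncomputable def lastEvent (N : ℝ≥0 → Ω → ℕ) (t : ℝ≥0) (ω : Ω) : ℝ≥0 :=
  arrival N (N t ω) ω

/-- `ℓ(t) = max {l ∈ ℕ : ω(t) + l δ ≤ t}`. -/
noncomputable def elapsedSteps (N : ℝ≥0 → Ω → ℕ) (δ : ℝ) (t : ℝ≥0) (ω : Ω) : ℕ :=
  ⌊((t : ℝ) - lastEvent N t ω) / δ⌋₊

open Classical in
/-- The intensity attached to the state `i` with `δ`-piecewise constant kernel,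
`λ^i_t = μ^i + ∑_{t_k < t} φ^i (ω(t) + ℓ(t) δ - t_k)`. -/
noncomputable def stateIntensity {M : ℕ} (μ : Fin M → ℝ) (φ : Fin M → ℝ → ℝ) (δ : ℝ)
    (N : ℝ≥0 → Ω → ℕ) (i : Fin M) (t : ℝ≥0) (ω : Ω) : ℝ :=
  μ i + ∑ k ∈ Finset.Icc 1 (N t ω), if arrival N k ω < t then
    φ i ((lastEvent N t ω : ℝ) + elapsedSteps N δ t ω * δ - arrival N k ω) else 0

/-- The conditional intensity `λ_t = ∑_i 1_{S_t = i} λ^i_t`. -/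
noncomputable def intensity {M : ℕ} (μ : Fin M → ℝ) (φ : Fin M → ℝ → ℝ) (δ : ℝ)
    (S : ℝ≥0 → Ω → Fin M) (N : ℝ≥0 → Ω → ℕ) (t : ℝ≥0) (ω : Ω) : ℝ :=
  ∑ i, if S t ω = i then stateIntensity μ φ δ N i t ω else 0

lemma IsCountingProcess.le_iff {N : ℝ≥0 → Ω → ℕ} (hN : IsCountingProcess N) (k : ℕ) (ω : Ω)
    (t : ℝ≥0) : eventTime N k ω ≤ t ↔ k ≤ N t ω := by
  unfold eventTime
  split_ifs with h
  · rw [WithTop.coe_le_coe]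
    constructor
    · intro hle
      -- the infimum is attained because the path is right-continuous
      have hat : k ≤ N (arrival N k ω) ω := by
        have hc := hN.rightCts ω (arrival N k ω)
        have h1 : ∀ᶠ s in nhdsWithin (arrival N k ω) (Set.Ici (arrival N k ω)),
            N s ω = N (arrival N k ω) ω := by
          have := hc (IsOpen.mem_nhds (isOpen_discrete {N (arrival N k ω) ω}) rfl)
          exact this
        obtain ⟨b, hb, hsub⟩ := (mem_nhdsGE_iff_exists_Ico_subset' (a := arrival N k ω)
          (u' := arrival N k ω + 1) (by simp)).1 h1
        obtain ⟨s, hs, hsb⟩ := exists_lt_of_csInf_lt (s := {t : ℝ≥0 | k ≤ N t ω}) h hb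
        have hge : arrival N k ω ≤ s := csInf_le (OrderBot.bddBelow _) hs
        have : N s ω = N (arrival N k ω) ω := hsub ⟨hge, hsb⟩
        exact this ▸ hs
      exact hat.trans (hN.mono ω hle)
    · intro hk
      exact csInf_le (OrderBot.bddBelow _) hk
  · simp only [top_le_iff, WithTop.coe_ne_top, false_iff]
    exact fun hk => h ⟨t, hk⟩

end Paths

section Filtrations

variable {Ω : Type*} [mΩ : MeasurableSpace Ω]

/-- The filtration `σ(X_s, 0 ≤ s ≤ t)` generated by a process. -/
noncomputable abbrev history {E : Type*} [TopologicalSpace E] [SecondCountableTopology E]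
    [TopologicalSpace.MetrizableSpace E] [MeasurableSpace E] [BorelSpace E] (X : ℝ≥0 → Ω → E)
    (hX : ∀ t, Measurable (X t)) : Filtration ℝ≥0 mΩ :=
  Filtration.natural X fun t => (hX t).stronglyMeasurable

/-- The filtration `σ(N_s, s ≤ t) ∨ σ(S_s, s ≥ 0)`, in which the whole path of `S` is known from the
beginning. -/
noncomputable abbrev enlargedHistory {M : ℕ} (S : ℝ≥0 → Ω → Fin M) (N : ℝ≥0 → Ω → ℕ)
    (hS : ∀ t, Measurable (S t)) (hN : ∀ t, Measurable (N t)) : Filtration ℝ≥0 mΩ :=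
  history N hN ⊔ Filtration.const ℝ≥0 (⨆ t, MeasurableSpace.comap (S t) inferInstance)
    (iSup_le fun t => (hS t).comap_le)

/-- A conservative generator matrix. -/
structure IsGenerator {M : ℕ} (Q : Matrix (Fin M) (Fin M) ℝ) : Prop where
  nonneg : ∀ i j, i ≠ j → 0 ≤ Q i j
  row_sum : ∀ i, ∑ j, Q i j = 0

open Classical in
/-- `lam` is a stochastic intensity of the counting process `N` in the filtration `𝓖`: for every
non-negative `𝓖`-predictable process `C`, `E ∫ C_t dN_t = E ∫ C_t lam_t dt`. -/
def HasIntensity (P : Measure Ω) (N : ℝ≥0 → Ω → ℕ) (𝓖 : Filtration ℝ≥0 mΩ)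
    (lam : ℝ≥0 → Ω → ℝ) : Prop :=
  ∀ C : ℝ≥0 × Ω → ℝ≥0∞, Measurable[𝓖.predictable] C →
    ∫⁻ ω, ∑' k : ℕ, (if ∃ t, k + 1 ≤ N t ω then C (arrival N (k + 1) ω, ω) else 0) ∂P
      = ∫⁻ ω, (∫⁻ t in Set.Ici (0 : ℝ),
          C (t.toNNReal, ω) * ENNReal.ofReal (lam t.toNNReal ω)) ∂P

/-- `(S, N)` is a Markov-modulated Hawkes process with `δ`-piecewise constant kernel: `S` is a
continuous-time Markov chain with generator `Q` relative to the joint history of `(S, N)`, and, given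
the whole path of `S`, the counting process `N` has the conditional intensity
`λ_t = ∑_i 1_{S_t = i} (μ^i + ∑_{t_k < t} φ^i (ω(t) + ℓ(t) δ - t_k))`. -/
structure IsMMHPDelta {M : ℕ} (P : Measure Ω) (Q : Matrix (Fin M) (Fin M) ℝ) (μ : Fin M → ℝ)
    (φ : Fin M → ℝ → ℝ) (δ : ℝ) (S : ℝ≥0 → Ω → Fin M) (N : ℝ≥0 → Ω → ℕ) : Prop where
  step_pos : 0 < δ
  generator : IsGenerator Q
  baseline_nonneg : ∀ i, 0 ≤ μ i
  kernel_nonneg : ∀ i t, 0 ≤ t → 0 ≤ φ i t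
  kernel_measurable : ∀ i, Measurable (φ i)
  counting : IsCountingProcess N
  chain_rightCts : ∀ ω t, ContinuousWithinAt (fun s => S s ω) (Set.Ici t) t
  measurable_chain : ∀ t, Measurable (S t)
  measurable_counting : ∀ t, Measurable (N t)
  markov : ∀ (s t : ℝ≥0) (j : Fin M),
    P[({ω | S (s + t) ω = j}).indicator (fun _ => (1 : ℝ)) |
        (history S measurable_chain ⊔ history N measurable_counting) s]
      =ᵐ[P] fun ω => NormedSpace.exp ((t : ℝ) • Q) (S s ω) j
  has_intensity : HasIntensity P N (enlargedHistory S N measurable_chain measurable_counting)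
    (intensity μ φ δ S N)

/-- The time `t_{n-1} + v`, equal to `⊤` if there are fewer than `n - 1` events. -/
noncomputable def timeAfter (N : ℝ≥0 → Ω → ℕ) (n : ℕ) (v : ℝ≥0) (ω : Ω) : WithTop ℝ≥0 :=
  eventTime N (n - 1) ω + (v : WithTop ℝ≥0)

/-- `t_{n-1} + v` is a stopping time of the filtration `𝓕_t = σ(N_s, s ≤ t)`. -/
lemma isStoppingTime_timeAfter {N : ℝ≥0 → Ω → ℕ} (hN : IsCountingProcess N)
    (hmeas : ∀ t, Measurable (N t)) (n : ℕ) (v : ℝ≥0) :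
    IsStoppingTime (history N hmeas) (timeAfter N n v) := by
  intro t
  by_cases hv : v ≤ t
  · have hset : {ω | timeAfter N n v ω ≤ t} = (N (t - v)) ⁻¹' Set.Ici (n - 1) := by
      ext ω
      have h1 : timeAfter N n v ω ≤ t ↔
          eventTime N (n - 1) ω ≤ ((t - v : ℝ≥0) : WithTop ℝ≥0) := by
        unfold timeAfter
        cases h : eventTime N (n - 1) ω with
        | top =>
          rw [WithTop.top_add]
          exact iff_of_false (WithTop.not_top_le_coe _) (WithTop.not_top_le_coe _)
        | coe a =>
          rw [← WithTop.coe_add, WithTop.coe_le_coe, WithTop.coe_le_coe, le_tsub_iff_right hv]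
      exact h1.trans (hN.le_iff (n - 1) ω (t - v))
    have hle : MeasurableSpace.comap (N (t - v)) inferInstance ≤ history N hmeas t :=
      le_iSup₂_of_le (t - v) tsub_le_self le_rfl
    exact hle _ (hset ▸ ⟨Set.Ici (n - 1), measurableSet_Ici, rfl⟩)
  · have hset : {ω | timeAfter N n v ω ≤ t} = ∅ := by
      ext ω
      have hlt : (t : WithTop ℝ≥0) < timeAfter N n v ω := by
        unfold timeAfter
        cases h : eventTime N (n - 1) ω with
        | top => rw [WithTop.top_add]; exact WithTop.coe_lt_top t
        | coe a =>
          rw [← WithTop.coe_add, WithTop.coe_lt_coe]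
          exact (not_le.1 hv).trans_le le_add_self
      exact iff_of_false hlt.not_ge (Set.notMem_empty ω)
    rw [hset]
    exact @MeasurableSet.empty _ (history N hmeas t)

/-- `P(S_{σ+w} = j, N_{σ+w} - N_σ = 0 | S_σ, 𝓕_σ)` for a stopping time `σ` of `𝓕_t = σ(N_s, s ≤ t)`
and `w ≥ 0`; it is meaningful on `{σ < ⊤}`. -/
noncomputable def noEventTransition {M : ℕ} (P : Measure Ω) (S : ℝ≥0 → Ω → Fin M)
    (N : ℝ≥0 → Ω → ℕ) (hmeas : ∀ t, Measurable (N t)) {σ : Ω → WithTop ℝ≥0}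
    (hσ : IsStoppingTime (history N hmeas) σ) (w : ℝ≥0) (j : Fin M) : Ω → ℝ :=
  P[({ω | S ((σ ω).untopA + w) ω = j ∧ N ((σ ω).untopA + w) ω = N (σ ω).untopA ω}).indicator
      (fun _ => (1 : ℝ)) |
    MeasurableSpace.comap (stoppedValue S σ) inferInstance ⊔ hσ.measurableSpace]

section Transition

variable {M : ℕ} {P : Measure Ω} {Q : Matrix (Fin M) (Fin M) ℝ} {μ : Fin M → ℝ}
  {φ : Fin M → ℝ → ℝ} {δ : ℝ} {S : ℝ≥0 → Ω → Fin M} {N : ℝ≥0 → Ω → ℕ}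

/-- Forward transition probabilities
`P(S_{t_{n-1}+u} = j, N_{t_{n-1}+u} - N_{t_{n-1}} = 0 | S_{t_{n-1}}, 𝓕_{t_{n-1}})`;
on `{S_{t_{n-1}} = i}` this is the entry `H^{(n)}_{ij}(u)`. -/
noncomputable def forwardTransition (h : IsMMHPDelta P Q μ φ δ S N) (n : ℕ) (u : ℝ≥0)
    (j : Fin M) : Ω → ℝ :=
  noEventTransition P S N h.measurable_counting
    (isStoppingTime_timeAfter h.counting h.measurable_counting n 0) u j

/-- Backward transition probabilities for `t_n = t_{n-1} + x`,
`P(S_{t_n} = j, N_{t_n} - N_{t_n - u} = 0 | S_{t_n - u}, 𝓕_{t_n - u})`, `0 ≤ u ≤ x`;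
on the event `{S_{t_n - u} = i}`, no event having occurred in `(t_{n-1}, t_n - u]`, this is the entry
`G^{(n)}_{ij}(u)`. -/
noncomputable def backwardTransition (h : IsMMHPDelta P Q μ φ δ S N) (n : ℕ) (x u : ℝ≥0)
    (j : Fin M) : Ω → ℝ :=
  noEventTransition P S N h.measurable_counting
    (isStoppingTime_timeAfter h.counting h.measurable_counting n (x - u)) u j

end Transition

end Filtrations

section Formulas

variable {Ω : Type*} {M : ℕ}

/-- The diagonal matrix `Λ_{t_{n-1} + k δ}` of the `M` intensities on the `k`-th `δ`-step after
`t_{n-1}` (up to the next event), with entries `μ^i + ∑_{l=1}^{n-1} φ^i (t_{n-1} + k δ - t_l)`. -/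
noncomputable def stepLambda (μ : Fin M → ℝ) (φ : Fin M → ℝ → ℝ) (δ : ℝ) (N : ℝ≥0 → Ω → ℕ)
    (n k : ℕ) (ω : Ω) : Matrix (Fin M) (Fin M) ℝ :=
  Matrix.diagonal fun i => μ i + ∑ l ∈ Finset.Icc 1 (n - 1),
    φ i ((arrival N (n - 1) ω : ℝ) + k * δ - arrival N l ω)

/-- `Ξ_k = ∏_{r=1}^k exp ((Q - Λ_{r-1}) δ)`, factors in increasing order from left to right;
`L k` stands for `Λ_{t_{n-1} + k δ}`. -/
noncomputable def Xi (Q : Matrix (Fin M) (Fin M) ℝ) (L : ℕ → Matrix (Fin M) (Fin M) ℝ) (δ : ℝ)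
    (k : ℕ) : Matrix (Fin M) (Fin M) ℝ :=
  ((List.range' 1 k).map fun r => NormedSpace.exp (δ • (Q - L (r - 1)))).prod

/-- `Ψ_k = ∏_{r=1}^k exp ((Q - Λ_{ℓ-(k-r)-1}) δ)`, for `k ≤ ℓ`, factors in increasing order from left
to right. -/
noncomputable def Psi (Q : Matrix (Fin M) (Fin M) ℝ) (L : ℕ → Matrix (Fin M) (Fin M) ℝ) (δ : ℝ)
    (l k : ℕ) : Matrix (Fin M) (Fin M) ℝ :=
  ((List.range' 1 k).map fun r => NormedSpace.exp (δ • (Q - L (l - (k - r) - 1)))).prod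

/-- The closed form of the forward transition matrix, with `ℓ(t_{n-1} + u) = ⌊u / δ⌋`. -/
noncomputable def forwardFormula (Q : Matrix (Fin M) (Fin M) ℝ)
    (L : ℕ → Matrix (Fin M) (Fin M) ℝ) (δ u : ℝ) : Matrix (Fin M) (Fin M) ℝ :=
  Xi Q L δ ⌊u / δ⌋₊ * NormedSpace.exp ((u - ⌊u / δ⌋₊ * δ) • (Q - L ⌊u / δ⌋₊))

/-- `ℓ_n = ℓ(t_n^-)`, the largest `l ∈ ℕ` with `l δ < x` for a duration `x = t_n - t_{n-1} > 0`. -/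
noncomputable def fullSteps (δ x : ℝ) : ℕ := ⌈x / δ⌉₊ - 1

/-- `Δ_n = x - ℓ_n δ`, for a duration `x = t_n - t_{n-1}`. -/
noncomputable def residualTime (δ x : ℝ) : ℝ := x - fullSteps δ x * δ

open Classical in
/-- The closed form of the backward transition matrix, for a duration `x = t_n - t_{n-1} > 0` and
`0 ≤ u ≤ x`; `⌊(x - u) / δ⌋ = ℓ(t_n - u)`. -/
noncomputable def backwardFormula (Q : Matrix (Fin M) (Fin M) ℝ)
    (L : ℕ → Matrix (Fin M) (Fin M) ℝ) (δ x u : ℝ) : Matrix (Fin M) (Fin M) ℝ :=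
  if u ≤ residualTime δ x then NormedSpace.exp (u • (Q - L (fullSteps δ x)))
  else
    NormedSpace.exp ((u - (((fullSteps δ x : ℝ) - ⌊(x - u) / δ⌋₊ - 1) * δ + residualTime δ x)) •
        (Q - L ⌊(x - u) / δ⌋₊)) *
      Psi Q L δ (fullSteps δ x) (fullSteps δ x - ⌊(x - u) / δ⌋₊ - 1) *
      NormedSpace.exp (residualTime δ x • (Q - L (fullSteps δ x)))

end Formulas

end MMHP

/-!
The conditional probabilities are those of the chain `S` killed at the rate `Λ`, and on a `δ`-step the
rate of each state is a random variable already known at `t_{n-1}`. So the claim is the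
Kolmogorov equation of a killed chain, with the matrix `Q - Λ` frozen on each step; the work
is to obtain it from the Markov property of `S` and the intensity of `N` alone, at the random times
`t_{n-1} + s`. Below `p` stands for `n - 1`.

Expectations are taken against bounded weights known at `t_p + s`, where "known" refers to the joint
history of `(S, N)` (`jointAt`). Two facts drive the argument.

* `integral_mul_strong_markov`: at the stopping time `t_p + s` the chain moves by `exp (t Q)`. It follows
  from the Markov property at fixed times by approximating the stopping time from the right.
* `measure_event_eq_lintegral`: integrating the predictable indicator of
  `(t_p + s, t_p + s + x] ∩ (0, t_{p+1}]` against `dN` gives the probability of an event in this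
  interval as the mean of the integrated rate. The event that `S` is in a given state at the *end* of
  the interval may be included in the weight, as the enlarged history contains the path of `S`.
  As the chain moves with probability `O(x)` in time `x`, the probability of an event is, up to
  `O(x²)`, `x` times the rate of that final state (`exists_kill_bound`).

Hence in time `x` the state and the survival up to then are described by `exp (x Q) (1 - x Λ)` up to
`O(x²)`, which is `exp (x (Q - Λ))` up to `O(x²)` (`exists_splitting_bound`). Summing over a
partition with mesh tending to `0` makes the error vanish, so that within a step the transition matrix is
exactly the exponential (`isTransition_stepExp`). All bounds are uniform on the event that the finitely
many rates involved are at most `K`, and these events exhaust the space as `K` grows.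
Transitions compose by matrix multiplication (`IsTransition.trans`), and both closed forms are the
product of the step exponentials over the time interval in question.
-/

namespace MMHP

/-! ### Taylor bounds for the exponential in a Banach algebra -/

section ExpBounds

open scoped Nat in
/-- Taylor remainder of the exponential in a Banach algebra. -/
lemma norm_exp_sub_sum_le {𝔸 : Type*} [NormedRing 𝔸] [NormedAlgebra ℝ 𝔸] [CompleteSpace 𝔸]
    (A : 𝔸) {k : ℕ} (hk : 0 < k) :
    ‖NormedSpace.exp A - ∑ i ∈ Finset.range k, ((i ! : ℝ)⁻¹) • A ^ i‖
      ≤ ‖A‖ ^ k * Real.exp ‖A‖ := by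
  have h1 := NormedSpace.exp_series_hasSum_exp' (𝕂 := ℝ) A
  have h2 := (hasSum_nat_add_iff' k).2 h1
  have h3 := (NormedSpace.exp_series_hasSum_exp' (𝕂 := ℝ) ‖A‖).mul_left (‖A‖ ^ k)
  rw [← Real.exp_eq_exp_ℝ] at h3
  rw [← h2.tsum_eq]
  refine tsum_of_norm_bounded h3 fun i => ?_
  rw [norm_smul, norm_inv, RCLike.norm_natCast, smul_eq_mul]
  have h4 : ‖A ^ (i + k)‖ ≤ ‖A‖ ^ k * ‖A‖ ^ i := by
    rw [← pow_add, add_comm k i]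
    exact norm_pow_le' A (by omega)
  have h5 : ((i + k)! : ℝ)⁻¹ ≤ (i ! : ℝ)⁻¹ := by
    gcongr
    omega
  calc ((i + k)! : ℝ)⁻¹ * ‖A ^ (i + k)‖ ≤ (i ! : ℝ)⁻¹ * (‖A‖ ^ k * ‖A‖ ^ i) := by gcongr
    _ = _ := by ring

lemma norm_exp_sub_one_le {𝔸 : Type*} [NormedRing 𝔸] [NormedAlgebra ℝ 𝔸] [CompleteSpace 𝔸]
    (A : 𝔸) : ‖NormedSpace.exp A - 1‖ ≤ ‖A‖ * Real.exp ‖A‖ := by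
  simpa using norm_exp_sub_sum_le A one_pos

lemma norm_exp_sub_one_sub_le {𝔸 : Type*} [NormedRing 𝔸] [NormedAlgebra ℝ 𝔸] [CompleteSpace 𝔸]
    (A : 𝔸) : ‖NormedSpace.exp A - 1 - A‖ ≤ ‖A‖ ^ 2 * Real.exp ‖A‖ := by
  have := norm_exp_sub_sum_le A (k := 2) (by norm_num)
  rw [Finset.sum_range_succ, Finset.sum_range_one] at this
  simpa [sub_sub] using this

/-- Lie splitting: `exp (h Q) (1 - h D)` and `exp (h (Q - D))` agree up to `O(h²)`, uniformly over
bounded `Q` and `D`. -/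
lemma norm_exp_mul_one_sub_sub_exp_le {𝔸 : Type*} [NormedRing 𝔸] [NormedAlgebra ℝ 𝔸]
    [CompleteSpace 𝔸] {q d : 𝔸} {K h : ℝ} (hq : ‖q‖ ≤ K) (hd : ‖d‖ ≤ K) (h0 : 0 ≤ h) (h1 : h ≤ 1) :
    ‖NormedSpace.exp (h • q) * (1 - h • d) - NormedSpace.exp (h • (q - d))‖
      ≤ (K ^ 2 + K ^ 2 * Real.exp K * (‖(1 : 𝔸)‖ + K) + (2 * K) ^ 2 * Real.exp (2 * K)) * h ^ 2 := by
  have hK : 0 ≤ K := (norm_nonneg _).trans hq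
  set e1 := NormedSpace.exp (h • q) - 1 - h • q with he1
  set e2 := NormedSpace.exp (h • (q - d)) - 1 - h • (q - d) with he2
  have hid : NormedSpace.exp (h • q) * (1 - h • d) - NormedSpace.exp (h • (q - d))
      = -(h ^ 2 • (q * d)) + e1 * (1 - h • d) - e2 := by
    have a1 : NormedSpace.exp (h • q) = e1 + 1 + h • q := by rw [he1]; abel
    have a2 : NormedSpace.exp (h • (q - d)) = e2 + 1 + h • (q - d) := by rw [he2]; abel
    rw [a1, a2, pow_two, mul_smul, smul_sub]
    simp only [mul_sub, add_mul, mul_one, one_mul, smul_mul_assoc, mul_smul_comm, smul_add]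
    abel
  have hn1 : ‖h • q‖ ≤ h * K := by rw [norm_smul, Real.norm_of_nonneg h0]; gcongr
  have hn1' : ‖h • d‖ ≤ h * K := by rw [norm_smul, Real.norm_of_nonneg h0]; gcongr
  have hn2 : ‖h • (q - d)‖ ≤ h * (2 * K) := by
    rw [norm_smul, Real.norm_of_nonneg h0]
    gcongr
    linarith [norm_sub_le q d]
  have hK1 : h * K ≤ K := mul_le_of_le_one_left hK h1
  have b1 : ‖e1‖ ≤ (h * K) ^ 2 * Real.exp K := by
    refine (norm_exp_sub_one_sub_le _).trans ?_
    gcongr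
    exact hn1.trans hK1
  have b2 : ‖e2‖ ≤ (h * (2 * K)) ^ 2 * Real.exp (2 * K) := by
    refine (norm_exp_sub_one_sub_le _).trans ?_
    gcongr
    exact hn2.trans (mul_le_of_le_one_left (by positivity) h1)
  have b3 : ‖h ^ 2 • (q * d)‖ ≤ h ^ 2 * (K * K) := by
    rw [norm_smul, Real.norm_of_nonneg (by positivity)]
    gcongr
    exact (norm_mul_le _ _).trans (by gcongr)
  have b4 : ‖(1 : 𝔸) - h • d‖ ≤ ‖(1 : 𝔸)‖ + K :=
    (norm_sub_le _ _).trans (by linarith)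
  rw [hid]
  calc _ ≤ ‖h ^ 2 • (q * d)‖ + ‖e1 * (1 - h • d)‖ + ‖e2‖ := by
        refine (norm_sub_le _ _).trans ?_
        gcongr
        refine (norm_add_le _ _).trans ?_
        rw [norm_neg]
    _ ≤ h ^ 2 * (K * K) + (h * K) ^ 2 * Real.exp K * (‖(1 : 𝔸)‖ + K)
        + (h * (2 * K)) ^ 2 * Real.exp (2 * K) := by
        gcongr
        exact (norm_mul_le _ _).trans (by gcongr)
    _ = _ := by ring

end ExpBounds

/-! ### Entrywise bounds for matrix exponentials -/

section MatrixExp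

open Matrix

variable {M : ℕ}

attribute [local instance] Matrix.linftyOpNormedRing Matrix.linftyOpNormedAlgebra

lemma abs_entry_le_norm (A : Matrix (Fin M) (Fin M) ℝ) (i j : Fin M) : |A i j| ≤ ‖A‖ := by
  have h1 : ∑ j, ‖A i j‖₊ ≤ ‖A‖₊ := by
    rw [Matrix.linfty_opNNNorm_def]
    exact Finset.le_sup (f := fun i => ∑ j, ‖A i j‖₊) (Finset.mem_univ i)
  have h2 : ‖A i j‖₊ ≤ ∑ j, ‖A i j‖₊ :=
    Finset.single_le_sum (f := fun j => ‖A i j‖₊) (fun _ _ => zero_le) (Finset.mem_univ j)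
  exact_mod_cast h2.trans h1

lemma norm_diagonal_le {K : ℝ} (hK : 0 ≤ K) {d : Fin M → ℝ} (hd : ∀ i, |d i| ≤ K) :
    ‖(diagonal d : Matrix (Fin M) (Fin M) ℝ)‖ ≤ K := by
  rw [Matrix.linfty_opNorm_diagonal]
  exact (pi_norm_le_iff_of_nonneg hK).2 hd

lemma exists_splitting_bound (Q : Matrix (Fin M) (Fin M) ℝ) {K : ℝ} (hK : 0 ≤ K) :
    ∃ C, 0 ≤ C ∧ ∀ d : Fin M → ℝ, (∀ i, |d i| ≤ K) → ∀ h : ℝ, 0 ≤ h → h ≤ 1 → ∀ i j,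
      |(NormedSpace.exp (h • Q) * (1 - h • diagonal d)
        - NormedSpace.exp (h • (Q - diagonal d))) i j| ≤ C * h ^ 2 := by
  have hK' : 0 ≤ max K ‖Q‖ := hK.trans (le_max_left _ _)
  refine ⟨_, ?_, fun d hd h h0 h1 i j => (abs_entry_le_norm _ i j).trans
    (norm_exp_mul_one_sub_sub_exp_le (K := max K ‖Q‖) (le_max_right _ _)
      ((norm_diagonal_le hK hd).trans (le_max_left _ _)) h0 h1)⟩
  positivity

lemma exists_exp_bound (Q : Matrix (Fin M) (Fin M) ℝ) {K H : ℝ} (hK : 0 ≤ K) :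
    ∃ C, 0 ≤ C ∧ ∀ d : Fin M → ℝ, (∀ i, |d i| ≤ K) → ∀ s : ℝ, 0 ≤ s → s ≤ H → ∀ i j,
      |NormedSpace.exp (s • (Q - diagonal d)) i j| ≤ C := by
  refine ⟨‖(1 : Matrix (Fin M) (Fin M) ℝ)‖ + |H| * (‖Q‖ + K) * Real.exp (|H| * (‖Q‖ + K)),
    by positivity, fun d hd s h0 h1 i j => (abs_entry_le_norm _ i j).trans ?_⟩
  have hn : ‖s • (Q - diagonal d)‖ ≤ |H| * (‖Q‖ + K) := by
    rw [norm_smul, Real.norm_of_nonneg h0]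
    have := norm_diagonal_le hK hd
    gcongr
    · exact h1.trans (le_abs_self H)
    · exact (norm_sub_le _ _).trans (by linarith)
  have h2 := norm_exp_sub_one_le (s • (Q - diagonal d))
  have h3 := norm_le_norm_add_norm_sub' (NormedSpace.exp (s • (Q - diagonal d))) 1
  refine h3.trans ?_
  gcongr
  exact h2.trans (by gcongr)

lemma exists_exp_sub_one_bound (Q : Matrix (Fin M) (Fin M) ℝ) :
    ∃ C, 0 ≤ C ∧ ∀ t : ℝ, 0 ≤ t → t ≤ 1 → ∀ i, |1 - NormedSpace.exp (t • Q) i i| ≤ C * t := by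
  refine ⟨‖Q‖ * Real.exp ‖Q‖, by positivity, fun t h0 h1 i => ?_⟩
  have h2 := (abs_entry_le_norm _ i i).trans (norm_exp_sub_one_le (t • Q))
  rw [Matrix.sub_apply, Matrix.one_apply_eq, abs_sub_comm] at h2
  refine h2.trans ?_
  rw [norm_smul, Real.norm_of_nonneg h0]
  have : t * ‖Q‖ ≤ ‖Q‖ := mul_le_of_le_one_left (norm_nonneg _) h1
  calc t * ‖Q‖ * Real.exp (t * ‖Q‖) ≤ t * ‖Q‖ * Real.exp ‖Q‖ := by gcongr
    _ = _ := by ring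

lemma continuous_exp_sub_diagonal (Q : Matrix (Fin M) (Fin M) ℝ) (t : ℝ) (i j : Fin M) :
    Continuous fun d : Fin M → ℝ => NormedSpace.exp (t • (Q - diagonal d)) i j := by
  have h1 : Continuous fun d : Fin M → ℝ => NormedSpace.exp (t • (Q - diagonal d)) := by
    have h0 : Continuous fun d : Fin M → ℝ => t • (Q - diagonal d) :=
      (continuous_const.sub continuous_id.matrix_diagonal).const_smul t
    exact (NormedSpace.exp_continuous (𝔸 := Matrix (Fin M) (Fin M) ℝ)).comp h0
  exact h1.matrix_elem i j

lemma exp_add_smul (A : Matrix (Fin M) (Fin M) ℝ) (s t : ℝ) :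
    NormedSpace.exp ((s + t) • A) = NormedSpace.exp (s • A) * NormedSpace.exp (t • A) := by
  rw [add_smul]
  exact Matrix.exp_add_of_commute _ _ (((Commute.refl A).smul_left s).smul_right t)

end MatrixExp


/-! ### Measurability of right-continuous processes -/

section RightContinuous

open Filter Topology

/-- The smallest multiple of `1 / (m + 1)` above `s`. -/
noncomputable def gridUp (m : ℕ) (s : ℝ≥0) : ℝ≥0 := (⌈((m : ℝ≥0) + 1) * s⌉₊ : ℝ≥0) / (m + 1)

lemma le_gridUp (m : ℕ) (s : ℝ≥0) : s ≤ gridUp m s := by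
  rw [gridUp, le_div_iff₀ (by positivity), mul_comm]
  exact Nat.le_ceil _

lemma gridUp_le (m : ℕ) (s : ℝ≥0) : gridUp m s ≤ s + 1 / ((m : ℝ≥0) + 1) := by
  rw [gridUp, div_le_iff₀ (by positivity), add_mul s, one_div, inv_mul_cancel₀ (by positivity),
    mul_comm s]
  exact (Nat.ceil_lt_add_one (by positivity)).le

lemma tendsto_gridUp (s : ℝ≥0) : Tendsto (fun m => gridUp m s) atTop (𝓝[≥] s) := by
  refine tendsto_nhdsWithin_iff.2 ⟨?_, Eventually.of_forall fun m => le_gridUp m s⟩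
  refine tendsto_of_tendsto_of_tendsto_of_le_of_le tendsto_const_nhds ?_
    (fun m => le_gridUp m s) (fun m => gridUp_le m s)
  have h := tendsto_one_div_add_atTop_nhds_zero_nat (𝕜 := ℝ≥0)
  simpa using h.const_add s

variable {Ω E : Type*} [TopologicalSpace E] [TopologicalSpace.PseudoMetrizableSpace E]
  [MeasurableSpace E] [BorelSpace E]

/-- A right-continuous process is jointly measurable. -/
lemma measurable_uncurry_of_rightCts [MeasurableSpace Ω] {X : ℝ≥0 → Ω → E}
    (hm : ∀ t, Measurable (X t)) (hc : ∀ ω t, ContinuousWithinAt (fun s => X s ω) (Set.Ici t) t) :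
    Measurable fun p : ℝ≥0 × Ω => X p.1 p.2 := by
  refine measurable_of_tendsto_metrizable
    (f := fun m (p : ℝ≥0 × Ω) => X (gridUp m p.1) p.2) (fun m => ?_)
    (tendsto_pi_nhds.2 fun p => (hc p.2 p.1).tendsto.comp (tendsto_gridUp p.1))
  have h1 : Measurable fun q : ℕ × Ω => X ((q.1 : ℝ≥0) / (m + 1)) q.2 :=
    measurable_from_prod_countable_right fun k => hm ((k : ℝ≥0) / (m + 1))
  have h2 : Measurable fun p : ℝ≥0 × Ω => (⌈((m : ℝ≥0) + 1) * p.1⌉₊, p.2) :=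
    (Nat.measurable_ceil.comp (measurable_fst.const_mul _)).prodMk measurable_snd
  exact h1.comp h2

lemma measurable_uncurry_Iic_of_rightCts [MeasurableSpace Ω] {X : ℝ≥0 → Ω → E} {i : ℝ≥0}
    (hm : ∀ t ≤ i, Measurable (X t))
    (hc : ∀ ω t, ContinuousWithinAt (fun s => X s ω) (Set.Ici t) t) :
    Measurable fun p : Set.Iic i × Ω => X p.1 p.2 := by
  have h1 : Measurable fun p : ℝ≥0 × Ω => X (min p.1 i) p.2 := by
    refine measurable_uncurry_of_rightCts (X := fun t ω => X (min t i) ω)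
      (fun t => hm _ (min_le_right _ _)) fun ω t => ?_
    refine (hc ω (min t i)).comp (t := Set.Ici (min t i)) (f := fun s => min s i) ?_
      fun s hs => min_le_min_right i hs
    exact (continuous_id.min continuous_const).continuousWithinAt
  have h2 : Measurable fun p : Set.Iic i × Ω => ((p.1 : ℝ≥0), p.2) :=
    (measurable_subtype_coe.comp measurable_fst).prodMk measurable_snd
  have h3 : (fun p : Set.Iic i × Ω => X p.1 p.2) = fun p => X (min (p.1 : ℝ≥0) i) p.2 := by
    funext p
    rw [min_eq_left p.1.2]
  rw [h3]
  exact h1.comp h2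

/-- A right-continuous adapted process is progressively measurable. -/
lemma isStronglyProgressive_of_rightCts [SecondCountableTopology E] {mΩ : MeasurableSpace Ω}
    (𝓖 : Filtration ℝ≥0 mΩ) {X : ℝ≥0 → Ω → E} (hm : ∀ t, Measurable[𝓖 t] (X t))
    (hc : ∀ ω t, ContinuousWithinAt (fun s => X s ω) (Set.Ici t) t) :
    IsStronglyProgressive 𝓖 X := fun i =>
  Measurable.stronglyMeasurable (mα := Subtype.instMeasurableSpace.prod (𝓖 i)) (@measurable_uncurry_Iic_of_rightCts Ω E _ _ _ _ (𝓖 i) X i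
      (fun t ht => (hm t).mono (𝓖.mono ht) le_rfl) hc)

end RightContinuous

/-! ### Predictable sets and stopping times -/

section Predictable

variable {Ω : Type*} [mΩ : MeasurableSpace Ω]

/-- The stochastic interval `(σ, ∞)` restricted to an event of `𝓖_σ` is predictable. -/
lemma measurableSet_predictable_stoppingTime_lt {𝓖 : Filtration ℝ≥0 mΩ} {σ : Ω → WithTop ℝ≥0}
    (hσ : IsStoppingTime 𝓖 σ) {B : Set Ω} (hB : MeasurableSet[hσ.measurableSpace] B) :
    MeasurableSet[𝓖.predictable] {p : ℝ≥0 × Ω | p.2 ∈ B ∧ σ p.2 < p.1} := by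
  obtain ⟨D, hDc, hDd⟩ := TopologicalSpace.exists_countable_dense ℝ≥0
  have hset : {p : ℝ≥0 × Ω | p.2 ∈ B ∧ σ p.2 < p.1}
      = ⋃ q ∈ D, Set.Ioi q ×ˢ (B ∩ {ω | σ ω ≤ q}) := by
    ext ⟨t, ω⟩
    simp only [Set.mem_ofPred_eq, Set.mem_iUnion, Set.mem_prod, Set.mem_Ioi, Set.mem_inter_iff,
      exists_prop]
    constructor
    · rintro ⟨hω, hlt⟩
      obtain ⟨a, ha⟩ := WithTop.ne_top_iff_exists.1 (hlt.trans_le le_top).ne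
      rw [← ha, WithTop.coe_lt_coe] at hlt
      obtain ⟨q, hq, h1, h2⟩ := hDd.exists_between hlt
      exact ⟨q, hq, h2, hω, by rw [← ha]; exact WithTop.coe_le_coe.2 h1.le⟩
    · rintro ⟨q, _, h2, hω, h1⟩
      exact ⟨hω, h1.trans_lt (WithTop.coe_lt_coe.2 h2)⟩
  rw [hset]
  exact @MeasurableSet.biUnion _ _ 𝓖.predictable _ _ hDc fun q _ =>
    measurableSet_predictable_Ioi_prod (hB.2 q)

/-- A stopping time remains one in a larger filtration. -/
lemma isStoppingTime_mono {𝓕 𝓖 : Filtration ℝ≥0 mΩ} (hle : 𝓕 ≤ 𝓖) {σ : Ω → WithTop ℝ≥0}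
    (hσ : IsStoppingTime 𝓕 σ) : IsStoppingTime 𝓖 σ := fun t => hle t _ (hσ t)

lemma stoppingTime_measurableSpace_mono {𝓕 𝓖 : Filtration ℝ≥0 mΩ} (hle : 𝓕 ≤ 𝓖)
    {σ : Ω → WithTop ℝ≥0} (hσ : IsStoppingTime 𝓕 σ) (hσ' : IsStoppingTime 𝓖 σ) :
    hσ.measurableSpace ≤ hσ'.measurableSpace :=
  fun _ hs => ⟨iSup_mono hle _ hs.1, fun i => hle i _ (hs.2 i)⟩

end Predictable

/-! ### Integrals against bounded weights -/

section Weights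

variable {Ω : Type*} [mΩ : MeasurableSpace Ω] {P : Measure Ω} [IsProbabilityMeasure P]

/-- Equality of integrals over all events of `m` below `A` extends to bounded `m`-measurable weights
vanishing outside `A`. -/
lemma integral_mul_eq_of_setIntegral_eq {m : MeasurableSpace Ω} (hm : m ≤ mΩ) {U V : Ω → ℝ}
    {A : Set Ω} (hA : MeasurableSet[m] A) (hU : IntegrableOn U A P) (hV : IntegrableOn V A P)
    (hUV : ∀ B, MeasurableSet[m] B → B ⊆ A → ∫ ω in B, U ω ∂P = ∫ ω in B, V ω ∂P)
    {Y : Ω → ℝ} (hY : Measurable[m] Y) {b : ℝ} (hb : ∀ ω, |Y ω| ≤ b) (hYA : ∀ ω, ω ∉ A → Y ω = 0) :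
    ∫ ω, Y ω * U ω ∂P = ∫ ω, Y ω * V ω ∂P := by
  have key : ∀ W : Ω → ℝ, IntegrableOn W A P →
      ∫ ω, Y ω * W ω ∂P = ∫ ω, Y ω * (P[A.indicator W | m]) ω ∂P := by
    intro W hW
    have hW' : Integrable (A.indicator W) P := hW.integrable_indicator (hm _ hA)
    have h1 : (fun ω => Y ω * W ω) = Y * A.indicator W := by
      funext ω
      by_cases hω : ω ∈ A
      · simp [hω]
      · simp [hω, hYA ω hω]
    have hYW : Integrable (Y * A.indicator W) P :=
      hW'.bdd_mul (hY.mono hm le_rfl).aestronglyMeasurable (Filter.Eventually.of_forall hb)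
    rw [h1, ← integral_condExp hm]
    exact integral_congr_ae (condExp_mul_of_stronglyMeasurable_left hY.stronglyMeasurable hYW hW')
  rw [key U hU, key V hV]
  have hU' : Integrable (A.indicator U) P := hU.integrable_indicator (hm _ hA)
  have hV' : Integrable (A.indicator V) P := hV.integrable_indicator (hm _ hA)
  have hce : P[A.indicator U | m] =ᵐ[P] P[A.indicator V | m] := by
    refine ae_eq_condExp_of_forall_setIntegral_eq hm hV'
      (fun s _ _ => integrable_condExp.integrableOn) (fun s hs _ => ?_)
      stronglyMeasurable_condExp.aestronglyMeasurable
    rw [setIntegral_condExp hm hU' hs, setIntegral_indicator (hm _ hA),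
      setIntegral_indicator (hm _ hA)]
    exact hUV _ (hs.inter hA) Set.inter_subset_right
  refine integral_congr_ae ?_
  filter_upwards [hce] with ω hω
  rw [hω]

end Weights

/-! ### Paths of a counting process -/

section CountingPaths

variable {Ω : Type*} {N : ℝ≥0 → Ω → ℕ}

lemma eventTime_ne_top_iff {k : ℕ} {ω : Ω} : eventTime N k ω ≠ ⊤ ↔ ∃ t, k ≤ N t ω := by
  unfold eventTime
  split_ifs with h
  · exact iff_of_true WithTop.coe_ne_top h
  · exact iff_of_false (fun h' => h' rfl) h

lemma eventTime_eq_arrival {k : ℕ} {ω : Ω} (h : ∃ t, k ≤ N t ω) :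
    eventTime N k ω = (arrival N k ω : WithTop ℝ≥0) := by
  unfold eventTime
  rw [if_pos h]

lemma arrival_eq_untopD (k : ℕ) (ω : Ω) : arrival N k ω = (eventTime N k ω).untopD 0 := by
  by_cases h : ∃ t, k ≤ N t ω
  · rw [eventTime_eq_arrival h, WithTop.untopD_coe]
  · have h2 : eventTime N k ω = ⊤ := by rwa [← eventTime_ne_top_iff, not_not] at h
    have h3 : {t : ℝ≥0 | k ≤ N t ω} = ∅ := by
      ext t
      exact ⟨fun ht => h ⟨t, ht⟩, fun ht => ht.elim⟩
    rw [h2, WithTop.untopD_top, arrival, h3, NNReal.sInf_empty]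

namespace IsCountingProcess

lemma arrival_le_iff (hN : IsCountingProcess N) {k : ℕ} {ω : Ω} (h : ∃ t, k ≤ N t ω) (t : ℝ≥0) :
    arrival N k ω ≤ t ↔ k ≤ N t ω := by
  rw [← hN.le_iff, eventTime_eq_arrival h, WithTop.coe_le_coe]

lemma apply_arrival (hN : IsCountingProcess N) {k : ℕ} {ω : Ω} (h : ∃ t, k ≤ N t ω) :
    N (arrival N k ω) ω = k := by
  refine le_antisymm ?_ ((hN.arrival_le_iff h _).1 le_rfl)
  rcases eq_or_lt_of_le (zero_le : 0 ≤ arrival N k ω) with h0 | h0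
  · rw [← h0, hN.zero]
    exact Nat.zero_le k
  · obtain ⟨s, hs, hle⟩ := hN.unit_jumps ω _ h0
    have : ¬ k ≤ N s ω := fun hk => hs.not_ge ((hN.arrival_le_iff h s).2 hk)
    omega

lemma eventTime_mono (hN : IsCountingProcess N) {l k : ℕ} (hlk : l ≤ k) (ω : Ω) :
    eventTime N l ω ≤ eventTime N k ω := by
  by_cases h : ∃ t, k ≤ N t ω
  · rw [eventTime_eq_arrival h, hN.le_iff, hN.apply_arrival h]
    exact hlk
  · have h2 : eventTime N k ω = ⊤ := by rwa [← eventTime_ne_top_iff, not_not] at h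
    rw [h2]
    exact le_top

lemma arrival_mono (hN : IsCountingProcess N) {l k : ℕ} (hlk : l ≤ k) {ω : Ω}
    (h : ∃ t, k ≤ N t ω) : arrival N l ω ≤ arrival N k ω := by
  rw [hN.arrival_le_iff (h.imp fun t ht => hlk.trans ht), hN.apply_arrival h]
  exact hlk

lemma arrival_lt_arrival_succ (hN : IsCountingProcess N) {k : ℕ} {ω : Ω}
    (h : ∃ t, k + 1 ≤ N t ω) : arrival N k ω < arrival N (k + 1) ω := by
  by_contra! hle
  rw [hN.arrival_le_iff h, hN.apply_arrival (h.imp fun t ht => (Nat.le_succ k).trans ht)] at hle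
  omega

end IsCountingProcess
end CountingPaths

/-! ### Histories stopped at `t_p + s` -/

section Stopped

open Filter Topology

variable {Ω : Type*} [mΩ : MeasurableSpace Ω] {E : Type*} [TopologicalSpace E]
  [TopologicalSpace.PseudoMetrizableSpace E] [MeasurableSpace E] [BorelSpace E]

/-- The value of a progressive process at a stopping time which is replaced by the constant `c` where
it is infinite. -/
lemma measurable_apply_untopD {𝓖 : Filtration ℝ≥0 mΩ} {u : ℝ≥0 → Ω → E}
    (hu : IsStronglyProgressive 𝓖 u) {τ : Ω → WithTop ℝ≥0} (hτ : IsStoppingTime 𝓖 τ) (c : ℝ≥0) :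
    Measurable[hτ.measurableSpace] fun ω => u ((τ ω).untopD c) ω := by
  intro A hA
  have htop : MeasurableSet[hτ.measurableSpace] {ω | τ ω = ⊤} :=
    hτ.measurable (measurableSet_singleton ⊤)
  have hset : (fun ω => u ((τ ω).untopD c) ω) ⁻¹' A
      = ({ω | τ ω = ⊤} ∩ u c ⁻¹' A) ∪ (stoppedValue u τ ⁻¹' A \ {ω | τ ω = ⊤}) := by
    ext ω
    by_cases hω : τ ω = ⊤
    · simp [hω]
    · obtain ⟨a, ha⟩ := WithTop.ne_top_iff_exists.1 hω
      have h1 : (τ ω).untopD c = (τ ω).untopA := by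
        rw [← ha]
        rfl
      simp [hω, stoppedValue, h1]
  rw [hset]
  refine MeasurableSet.union ⟨?_, fun i => ?_⟩ (MeasurableSet.diff (measurable_stoppedValue hu hτ hA)
    htop)
  · have hc : Measurable[⨆ t, 𝓖 t] (u c) :=
      (hu.stronglyAdapted c).measurable.mono (le_iSup 𝓖 c) le_rfl
    exact MeasurableSet.inter (hτ.measurableSpace_le' _ htop) (hc hA)
  · have : {ω | τ ω = ⊤} ∩ u c ⁻¹' A ∩ {ω | τ ω ≤ i} = ∅ := by
      ext ω
      refine ⟨fun ⟨⟨h1, _⟩, h2⟩ => ?_, fun h => h.elim⟩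
      have h1' : τ ω = ⊤ := h1
      have h2' : τ ω ≤ i := h2
      rw [h1'] at h2'
      exact WithTop.not_top_le_coe _ h2'
    rw [this]
    exact @MeasurableSet.empty _ (𝓖 i)

end Stopped

section Clock

variable {Ω : Type*} {N : ℝ≥0 → Ω → ℕ}

lemma timeAfter_mono (p : ℕ) {s s' : ℝ≥0} (hs : s ≤ s') :
    timeAfter N (p + 1) s ≤ timeAfter N (p + 1) s' :=
  fun _ => add_le_add le_rfl (WithTop.coe_le_coe.2 hs)

lemma timeAfter_eq_coe {p : ℕ} {ω : Ω} (hω : ∃ t, p ≤ N t ω) (s : ℝ≥0) :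
    timeAfter N (p + 1) s ω = ((arrival N p ω + s : ℝ≥0) : WithTop ℝ≥0) := by
  change eventTime N p ω + _ = _
  rw [eventTime_eq_arrival hω, WithTop.coe_add]

lemma timeAfter_ne_top_iff {p : ℕ} {ω : Ω} (s : ℝ≥0) :
    timeAfter N (p + 1) s ω ≠ ⊤ ↔ ∃ t, p ≤ N t ω := by
  constructor
  · intro h
    rw [← eventTime_ne_top_iff]
    intro h2
    refine h ?_
    change eventTime N p ω + _ = _
    rw [h2, WithTop.top_add]
  · intro h
    rw [timeAfter_eq_coe h]
    exact WithTop.coe_ne_top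

lemma arrival_add_eq_untopD (p : ℕ) (s : ℝ≥0) (ω : Ω) :
    arrival N p ω + s = (timeAfter N (p + 1) s ω).untopD s := by
  by_cases hω : ∃ t, p ≤ N t ω
  · rw [timeAfter_eq_coe hω, WithTop.untopD_coe]
  · have h1 : timeAfter N (p + 1) s ω = ⊤ := by
      rwa [← timeAfter_ne_top_iff (N := N) s, not_not] at hω
    have h2 : eventTime N p ω = ⊤ := by rwa [← eventTime_ne_top_iff, not_not] at hω
    rw [h1, WithTop.untopD_top, arrival_eq_untopD, h2, WithTop.untopD_top, zero_add]

lemma untopA_timeAfter {p : ℕ} {ω : Ω} (hω : ∃ t, p ≤ N t ω) (s : ℝ≥0) :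
    (timeAfter N (p + 1) s ω).untopA = arrival N p ω + s := by
  rw [timeAfter_eq_coe hω]
  rfl

end Clock

section StoppedHistories

variable {Ω : Type*} [mΩ : MeasurableSpace Ω] {M : ℕ} {P : Measure Ω}
  {Q : Matrix (Fin M) (Fin M) ℝ} {μ : Fin M → ℝ}
  {φ : Fin M → ℝ → ℝ} {δ : ℝ} {S : ℝ≥0 → Ω → Fin M} {N : ℝ≥0 → Ω → ℕ}

/-- The joint history `σ(S_s, N_s, s ≤ t)`. -/
noncomputable def jointHistory (h : IsMMHPDelta P Q μ φ δ S N) : Filtration ℝ≥0 mΩ :=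
  history S h.measurable_chain ⊔ history N h.measurable_counting

/-- The history of `N` enlarged by the whole path of `S`. -/
noncomputable def fullHistory (h : IsMMHPDelta P Q μ φ δ S N) : Filtration ℝ≥0 mΩ :=
  enlargedHistory S N h.measurable_chain h.measurable_counting

lemma history_le_jointHistory (h : IsMMHPDelta P Q μ φ δ S N) :
    history N h.measurable_counting ≤ jointHistory h := le_sup_right

lemma jointHistory_le_fullHistory (h : IsMMHPDelta P Q μ φ δ S N) :
    jointHistory h ≤ fullHistory h := by
  refine sup_le (le_sup_of_le_right fun t => ?_) le_sup_left
  exact iSup₂_le fun s _ => le_iSup (fun t => MeasurableSpace.comap (S t) inferInstance) s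

lemma stoppingTime_history (h : IsMMHPDelta P Q μ φ δ S N) (p : ℕ) (s : ℝ≥0) :
    IsStoppingTime (history N h.measurable_counting) (timeAfter N (p + 1) s) :=
  isStoppingTime_timeAfter h.counting h.measurable_counting (p + 1) s

lemma stoppingTime_joint (h : IsMMHPDelta P Q μ φ δ S N) (p : ℕ) (s : ℝ≥0) :
    IsStoppingTime (jointHistory h) (timeAfter N (p + 1) s) :=
  isStoppingTime_mono (history_le_jointHistory h) (stoppingTime_history h p s)

lemma stoppingTime_full (h : IsMMHPDelta P Q μ φ δ S N) (p : ℕ) (s : ℝ≥0) :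
    IsStoppingTime (fullHistory h) (timeAfter N (p + 1) s) :=
  isStoppingTime_mono (jointHistory_le_fullHistory h) (stoppingTime_joint h p s)

/-- The history of `N` stopped at `t_p + s`. -/
noncomputable abbrev histAt (h : IsMMHPDelta P Q μ φ δ S N) (p : ℕ) (s : ℝ≥0) :
    MeasurableSpace Ω := (stoppingTime_history h p s).measurableSpace

/-- The joint history of `(S, N)` stopped at `t_p + s`. -/
noncomputable abbrev jointAt (h : IsMMHPDelta P Q μ φ δ S N) (p : ℕ) (s : ℝ≥0) :
    MeasurableSpace Ω := (stoppingTime_joint h p s).measurableSpace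

/-- The history of `N` enlarged by the path of `S`, stopped at `t_p + s`. -/
noncomputable abbrev fullAt (h : IsMMHPDelta P Q μ φ δ S N) (p : ℕ) (s : ℝ≥0) :
    MeasurableSpace Ω := (stoppingTime_full h p s).measurableSpace

lemma histAt_le_jointAt (h : IsMMHPDelta P Q μ φ δ S N) (p : ℕ) (s : ℝ≥0) :
    histAt h p s ≤ jointAt h p s :=
  stoppingTime_measurableSpace_mono (history_le_jointHistory h) _ _

lemma jointAt_le_fullAt (h : IsMMHPDelta P Q μ φ δ S N) (p : ℕ) (s : ℝ≥0) :
    jointAt h p s ≤ fullAt h p s :=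
  stoppingTime_measurableSpace_mono (jointHistory_le_fullHistory h) _ _

lemma histAt_mono (h : IsMMHPDelta P Q μ φ δ S N) (p : ℕ) {s s' : ℝ≥0} (hs : s ≤ s') :
    histAt h p s ≤ histAt h p s' :=
  IsStoppingTime.measurableSpace_mono _ _ (timeAfter_mono p hs)

lemma jointAt_mono (h : IsMMHPDelta P Q μ φ δ S N) (p : ℕ) {s s' : ℝ≥0} (hs : s ≤ s') :
    jointAt h p s ≤ jointAt h p s' :=
  IsStoppingTime.measurableSpace_mono _ _ (timeAfter_mono p hs)

lemma histAt_le (h : IsMMHPDelta P Q μ φ δ S N) (p : ℕ) (s : ℝ≥0) : histAt h p s ≤ mΩ :=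
  IsStoppingTime.measurableSpace_le _

lemma jointAt_le (h : IsMMHPDelta P Q μ φ δ S N) (p : ℕ) (s : ℝ≥0) : jointAt h p s ≤ mΩ :=
  IsStoppingTime.measurableSpace_le _

lemma fullAt_le (h : IsMMHPDelta P Q μ φ δ S N) (p : ℕ) (s : ℝ≥0) : fullAt h p s ≤ mΩ :=
  IsStoppingTime.measurableSpace_le _

lemma measurable_counting_at (h : IsMMHPDelta P Q μ φ δ S N) (p : ℕ) (s : ℝ≥0) :
    Measurable[histAt h p s] fun ω => N (arrival N p ω + s) ω := by
  simp_rw [arrival_add_eq_untopD p s]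
  refine measurable_apply_untopD (isStronglyProgressive_of_rightCts _ (fun t => ?_)
    h.counting.rightCts) (stoppingTime_history h p s) s
  exact measurable_iff_comap_le.2 (le_iSup₂_of_le t le_rfl le_rfl)

lemma isStronglyProgressive_chain (h : IsMMHPDelta P Q μ φ δ S N) :
    IsStronglyProgressive (jointHistory h) S := by
  refine isStronglyProgressive_of_rightCts _ (fun t => ?_) h.chain_rightCts
  refine measurable_iff_comap_le.2 (le_trans ?_ (le_sup_left : _ ≤ jointHistory h t))
  exact le_iSup₂_of_le t le_rfl le_rfl

lemma measurable_chain_at (h : IsMMHPDelta P Q μ φ δ S N) (p : ℕ) (s : ℝ≥0) :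
    Measurable[jointAt h p s] fun ω => S (arrival N p ω + s) ω := by
  simp_rw [arrival_add_eq_untopD p s]
  exact measurable_apply_untopD (isStronglyProgressive_chain h) (stoppingTime_joint h p s) s

/-- In the enlarged history the future of the chain is known. -/
lemma measurable_chain_at_full (h : IsMMHPDelta P Q μ φ δ S N) (p : ℕ) (s r : ℝ≥0) :
    Measurable[fullAt h p s] fun ω => S (arrival N p ω + s + r) ω := by
  simp_rw [arrival_add_eq_untopD p s]
  refine measurable_apply_untopD (u := fun t ω => S (t + r) ω)
    (isStronglyProgressive_of_rightCts _ (fun t => ?_) fun ω t => ?_) (stoppingTime_full h p s) s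
  · refine measurable_iff_comap_le.2 (le_trans ?_ (le_sup_right : _ ≤ fullHistory h t))
    exact le_iSup (fun t => MeasurableSpace.comap (S t) inferInstance) (t + r)
  · exact (h.chain_rightCts ω (t + r)).comp (t := Set.Ici (t + r)) (f := fun s => s + r)
      (continuous_id.add continuous_const).continuousWithinAt fun s hs => add_le_add (Set.mem_Ici.1 hs) le_rfl

lemma measurable_arrival_le (h : IsMMHPDelta P Q μ φ δ S N) {l p : ℕ} (hl : l ≤ p) :
    Measurable[histAt h p 0] (arrival N l) := by
  have h1 : Measurable[(stoppingTime_history h l 0).measurableSpace] (timeAfter N (l + 1) 0) :=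
    (stoppingTime_history h l 0).measurable
  have h2 : histAt h l 0 ≤ histAt h p 0 :=
    IsStoppingTime.measurableSpace_mono _ _ fun ω =>
      add_le_add (h.counting.eventTime_mono hl ω) le_rfl
  have h3 : arrival N l = fun ω => (timeAfter N (l + 1) 0 ω).untopD 0 := by
    funext ω
    rw [← arrival_add_eq_untopD, add_zero]
  rw [h3]
  exact WithTop.measurable_untopD _ |>.comp (h1.mono h2 le_rfl)

lemma measurable_arrival (h : IsMMHPDelta P Q μ φ δ S N) (l : ℕ) : Measurable (arrival N l) :=
  (measurable_arrival_le h le_rfl).mono (histAt_le h l 0) le_rfl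

lemma measurableSet_reach (h : IsMMHPDelta P Q μ φ δ S N) (p : ℕ) (s : ℝ≥0) :
    MeasurableSet[histAt h p s] {ω | ∃ t, p ≤ N t ω} := by
  have h1 : {ω | ∃ t, p ≤ N t ω} = {ω | timeAfter N (p + 1) s ω = ⊤}ᶜ := by
    ext ω
    exact (timeAfter_ne_top_iff (N := N) s).symm
  rw [h1]
  exact ((stoppingTime_history h p s).measurable (measurableSet_singleton ⊤)).compl

end StoppedHistories

/-! ### The strong Markov property of the chain -/

section StrongMarkov

open Filter Topology

variable {Ω : Type*} [mΩ : MeasurableSpace Ω] {M : ℕ} {P : Measure Ω}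
  {Q : Matrix (Fin M) (Fin M) ℝ} {μ : Fin M → ℝ}
  {φ : Fin M → ℝ → ℝ} {δ : ℝ} {S : ℝ≥0 → Ω → Fin M} {N : ℝ≥0 → Ω → ℕ}

lemma measurable_chain_comp (h : IsMMHPDelta P Q μ φ δ S N) {r : Ω → ℝ≥0} (hr : Measurable r) :
    Measurable fun ω => S (r ω) ω :=
  (measurable_uncurry_of_rightCts h.measurable_chain h.chain_rightCts).comp
    (hr.prodMk measurable_id)

lemma measurable_counting_comp (h : IsMMHPDelta P Q μ φ δ S N) {r : Ω → ℝ≥0} (hr : Measurable r) :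
    Measurable fun ω => N (r ω) ω :=
  (measurable_uncurry_of_rightCts h.measurable_counting h.counting.rightCts).comp
    (hr.prodMk measurable_id)

variable [IsProbabilityMeasure P]

/-- A bounded function of a random element of a finite type is integrable on every event. -/
lemma integrable_comp_fin {f : Ω → Fin M} (hf : Measurable f) (w : Fin M → ℝ) :
    Integrable (fun ω => w (f ω)) P :=
  Integrable.of_bound ((measurable_of_countable w).comp hf).aestronglyMeasurable
    (∑ i, ‖w i‖) (Eventually.of_forall fun _ =>
      Finset.single_le_sum (f := fun i => ‖w i‖) (fun _ _ => norm_nonneg _) (Finset.mem_univ _))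

/-- The Markov property at a random time which takes its values in a grid. -/
lemma setIntegral_markov_gridUp (h : IsMMHPDelta P Q μ φ δ S N) {r : Ω → ℝ≥0} (hr : Measurable r)
    {A : Set Ω} (hAr : ∀ q, MeasurableSet[jointHistory h q] (A ∩ {ω | r ω ≤ q}))
    (m : ℕ) (t : ℝ≥0) (k : Fin M) :
    ∫ ω in A, (if S (gridUp m (r ω) + t) ω = k then (1 : ℝ) else 0) ∂P
      = ∫ ω in A, NormedSpace.exp ((t : ℝ) • Q) (S (gridUp m (r ω)) ω) k ∂P := by
  have hg : Measurable fun ω => gridUp m (r ω) :=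
    (measurable_from_nat.comp (Nat.measurable_ceil.comp (hr.const_mul _))).div_const _
  set c : Ω → ℕ := fun ω => ⌈((m : ℝ≥0) + 1) * r ω⌉₊ with hc
  have hle : ∀ (a : ℕ) ω, c ω ≤ a ↔ r ω ≤ (a : ℝ≥0) / (m + 1) := by
    intro a ω
    rw [hc, Nat.ceil_le, le_div_iff₀ (by positivity), mul_comm]
  have hAa : ∀ a : ℕ, MeasurableSet[jointHistory h ((a : ℝ≥0) / (m + 1))] (A ∩ {ω | c ω = a}) := by
    intro a
    have hset : A ∩ {ω | c ω = a} = (A ∩ {ω | r ω ≤ (a : ℝ≥0) / (m + 1)}) \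
        ⋃ b ∈ Finset.range a, (A ∩ {ω | r ω ≤ (b : ℝ≥0) / (m + 1)}) := by
      ext ω
      simp only [Set.mem_inter_iff, Set.mem_ofPred_eq, Set.mem_sdiff, Set.mem_iUnion, ← hle,
        Finset.mem_range, exists_prop, not_exists, not_and]
      constructor
      · rintro ⟨h1, h2⟩
        exact ⟨⟨h1, h2.le⟩, fun b hb _ => by omega⟩
      · rintro ⟨⟨h1, h2⟩, h3⟩
        refine ⟨h1, le_antisymm h2 ?_⟩
        by_contra! h4
        exact h3 _ h4 h1 le_rfl
    rw [hset]
    refine MeasurableSet.diff (hAr _) (Finset.measurableSet_biUnion _ fun b hb => ?_)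
    refine (jointHistory h).mono ?_ _ (hAr _)
    gcongr
    exact_mod_cast (Finset.mem_range.1 hb).le
  have hU : A = ⋃ a : ℕ, A ∩ {ω | c ω = a} := by
    ext ω
    simp
  have hdisj : Pairwise (Function.onFun Disjoint fun a : ℕ => A ∩ {ω | c ω = a}) := by
    intro a b hab
    refine Set.disjoint_left.2 fun ω h1 h2 => hab ?_
    exact h1.2.symm.trans h2.2
  have hm : ∀ a : ℕ, MeasurableSet (A ∩ {ω | c ω = a}) :=
    fun a => (jointHistory h).le _ _ (hAa a)
  have hi1 : Integrable (fun ω => if S (gridUp m (r ω) + t) ω = k then (1 : ℝ) else 0) P :=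
    integrable_comp_fin (measurable_chain_comp h (hg.add_const t)) fun i => if i = k then 1 else 0
  have hi2 : Integrable (fun ω => NormedSpace.exp ((t : ℝ) • Q) (S (gridUp m (r ω)) ω) k) P :=
    integrable_comp_fin (measurable_chain_comp h hg) fun i => NormedSpace.exp ((t : ℝ) • Q) i k
  rw [hU, integral_iUnion hm hdisj hi1.integrableOn, integral_iUnion hm hdisj hi2.integrableOn]
  congr 1
  funext a
  set q : ℝ≥0 := (a : ℝ≥0) / (m + 1) with hq
  have hgq : ∀ ω ∈ A ∩ {ω | c ω = a}, gridUp m (r ω) = q := by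
    rintro ω ⟨_, h2⟩
    have h2' : c ω = a := h2
    rw [hq, ← h2']
    rfl
  have hind : Integrable (({ω | S (q + t) ω = k}).indicator (fun _ => (1 : ℝ))) P :=
    (integrable_const 1).indicator (h.measurable_chain (q + t) (measurableSet_singleton k))
  calc _ = ∫ ω in A ∩ {ω | c ω = a},
          ({ω | S (q + t) ω = k}).indicator (fun _ => (1 : ℝ)) ω ∂P := by
        refine setIntegral_congr_fun (hm a) fun ω hω => ?_
        simp only [hgq ω hω, Set.indicator_apply, Set.mem_ofPred_eq]
    _ = ∫ ω in A ∩ {ω | c ω = a}, (P[({ω | S (q + t) ω = k}).indicator (fun _ => (1 : ℝ)) |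
          jointHistory h q]) ω ∂P :=
        (setIntegral_condExp ((jointHistory h).le q) hind (hAa a)).symm
    _ = ∫ ω in A ∩ {ω | c ω = a}, NormedSpace.exp ((t : ℝ) • Q) (S q ω) k ∂P :=
        integral_congr_ae (ae_restrict_of_ae (h.markov q t k))
    _ = _ := by
        refine setIntegral_congr_fun (hm a) fun ω hω => ?_
        simp only [hgq ω hω]

/-- The strong Markov property, by approximating the random time from the right along grids. -/
lemma setIntegral_strong_markov (h : IsMMHPDelta P Q μ φ δ S N) {r : Ω → ℝ≥0} (hr : Measurable r)
    {A : Set Ω} (hAr : ∀ q, MeasurableSet[jointHistory h q] (A ∩ {ω | r ω ≤ q}))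
    (t : ℝ≥0) (k : Fin M) :
    ∫ ω in A, (if S (r ω + t) ω = k then (1 : ℝ) else 0) ∂P
      = ∫ ω in A, NormedSpace.exp ((t : ℝ) • Q) (S (r ω) ω) k ∂P := by
  have hg : ∀ m, Measurable fun ω => gridUp m (r ω) := fun m =>
    (measurable_from_nat.comp (Nat.measurable_ceil.comp (hr.const_mul _))).div_const _
  have key : ∀ (t : ℝ≥0) (w : Fin M → ℝ),
      Tendsto (fun m => ∫ ω in A, w (S (gridUp m (r ω) + t) ω) ∂P) atTop
        (𝓝 (∫ ω in A, w (S (r ω + t) ω) ∂P)) := by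
    intro t w
    refine tendsto_integral_of_dominated_convergence (fun _ => ∑ i, ‖w i‖)
      (fun m => (integrable_comp_fin (measurable_chain_comp h
        ((hg m).add_const t)) w).integrableOn.aestronglyMeasurable)
      (integrable_const _) (fun m => Eventually.of_forall fun ω =>
        Finset.single_le_sum (f := fun i => ‖w i‖) (fun _ _ => norm_nonneg _) (Finset.mem_univ _))
      (Eventually.of_forall fun ω => ?_)
    have h1 : Tendsto (fun m => gridUp m (r ω) + t) atTop (𝓝[≥] (r ω + t)) := by
      refine tendsto_nhdsWithin_iff.2 ⟨?_, Eventually.of_forall fun m =>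
        Set.mem_Ici.2 (add_le_add (le_gridUp m (r ω)) le_rfl)⟩
      exact ((tendsto_gridUp (r ω)).mono_right nhdsWithin_le_nhds).add_const t
    exact ((continuous_of_discreteTopology (f := w)).tendsto _).comp
      ((h.chain_rightCts ω (r ω + t)).tendsto.comp h1)
  have h1 := key t fun i => if i = k then (1 : ℝ) else 0
  have h2 := key 0 fun i => NormedSpace.exp ((t : ℝ) • Q) i k
  simp only [add_zero] at h2
  refine tendsto_nhds_unique h1 (h2.congr fun m => ?_)
  exact (setIntegral_markov_gridUp h hr hAr m t k).symm

/-- The strong Markov property at `t_p + s` against bounded weights. -/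
lemma integral_mul_strong_markov (h : IsMMHPDelta P Q μ φ δ S N) (p : ℕ) (s t : ℝ≥0) (k : Fin M)
    {Y : Ω → ℝ} (hY : Measurable[jointAt h p s] Y) {b : ℝ} (hb : ∀ ω, |Y ω| ≤ b)
    (hYA : ∀ ω, ¬ (∃ t, p ≤ N t ω) → Y ω = 0) :
    ∫ ω, Y ω * (if S (arrival N p ω + s + t) ω = k then (1 : ℝ) else 0) ∂P
      = ∫ ω, Y ω * NormedSpace.exp ((t : ℝ) • Q) (S (arrival N p ω + s) ω) k ∂P := by
  have hr : Measurable fun ω => arrival N p ω + s := (measurable_arrival h p).add_const s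
  refine integral_mul_eq_of_setIntegral_eq (jointAt_le h p s)
    (histAt_le_jointAt h p s _ (measurableSet_reach h p s)) ?_ ?_ (fun B hB hBA => ?_) hY hb hYA
  · exact (integrable_comp_fin (measurable_chain_comp h (hr.add_const t))
      fun i => if i = k then 1 else 0).integrableOn
  · exact (integrable_comp_fin (measurable_chain_comp h hr)
      fun i => NormedSpace.exp ((t : ℝ) • Q) i k).integrableOn
  · refine setIntegral_strong_markov h hr (fun q => ?_) t k
    have h1 : B ∩ {ω | arrival N p ω + s ≤ q} = B ∩ {ω | timeAfter N (p + 1) s ω ≤ q} := by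
      ext ω
      refine and_congr_right fun hω => ?_
      change _ ↔ timeAfter N (p + 1) s ω ≤ q
      rw [timeAfter_eq_coe (hBA hω), WithTop.coe_le_coe]
      rfl
    rw [h1]
    exact hB.2 q

/-- The probability that the chain takes different values at `t_p + s` and `t_p + s + t` is at most
proportional to `t`. -/
lemma exists_chain_move_bound (h : IsMMHPDelta P Q μ φ δ S N) (p : ℕ) :
    ∃ C, 0 ≤ C ∧ ∀ s t : ℝ≥0, (t : ℝ) ≤ 1 →
      ∫ ω, ({ω | ∃ t, p ≤ N t ω}).indicator (fun _ => (1 : ℝ)) ω *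
        (if S (arrival N p ω + s) ω = S (arrival N p ω + s + t) ω then 0 else 1) ∂P ≤ C * t := by
  obtain ⟨C, hC, hbound⟩ := exists_exp_sub_one_bound Q
  refine ⟨C, hC, fun s t ht => ?_⟩
  set R : Set Ω := {ω | ∃ t, p ≤ N t ω} with hR
  have hRm : MeasurableSet[jointAt h p s] R :=
    histAt_le_jointAt h p s _ (measurableSet_reach h p s)
  have hr : Measurable fun ω => arrival N p ω + s := (measurable_arrival h p).add_const s
  -- on each event `{S = i}` the indicator of staying put is the indicator of being at `i` later
  set Y : Fin M → Ω → ℝ := fun i ω => R.indicator (fun _ => (1 : ℝ)) ω *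
    (if S (arrival N p ω + s) ω = i then 1 else 0) with hYdef
  have hY : ∀ i, Measurable[jointAt h p s] (Y i) := fun i =>
    (measurable_const.indicator hRm).mul
      ((measurable_of_countable fun k : Fin M => if k = i then (1 : ℝ) else 0).comp
        (measurable_chain_at h p s))
  have hYb : ∀ i ω, |Y i ω| ≤ 1 := by
    intro i ω
    by_cases hω : ω ∈ R
    · simp only [hYdef, Set.indicator_of_mem hω]
      split_ifs <;> simp
    · simp [hYdef, Set.indicator_of_notMem hω]
  have hY0 : ∀ i ω, ¬ (∃ t, p ≤ N t ω) → Y i ω = 0 := by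
    intro i ω hω
    have : ω ∉ R := hω
    simp [hYdef, this]
  have hYint : ∀ i, Integrable (Y i) P := fun i =>
    Integrable.of_bound ((hY i).mono (jointAt_le h p s) le_rfl).aestronglyMeasurable 1
      (Eventually.of_forall (hYb i))
  have hYw : ∀ i (w : Fin M → ℝ) (t : ℝ≥0),
      Integrable (fun ω => Y i ω * w (S (arrival N p ω + s + t) ω)) P := fun i w t =>
    (integrable_comp_fin (measurable_chain_comp h (hr.add_const t)) w).bdd_mul
      (hYint i).aestronglyMeasurable (Eventually.of_forall (hYb i))
  calc _ = ∫ ω, ∑ i, (Y i ω - Y i ω * (if S (arrival N p ω + s + t) ω = i then (1 : ℝ) else 0))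
          ∂P := by
        refine integral_congr_ae (Eventually.of_forall fun ω => ?_)
        simp only [hYdef]
        rw [Finset.sum_eq_single (S (arrival N p ω + s) ω)]
        · rw [if_pos rfl]
          by_cases h1 : S (arrival N p ω + s) ω = S (arrival N p ω + s + t) ω
          · rw [if_pos h1, if_pos h1.symm]
            ring
          · rw [if_neg h1, if_neg (Ne.symm h1)]
            ring
        · intro i _ hi
          rw [if_neg (Ne.symm hi)]
          ring
        · exact fun h1 => (h1 (Finset.mem_univ _)).elim
    _ = ∑ i, (∫ ω, Y i ω ∂P - ∫ ω, Y i ω * (if S (arrival N p ω + s + t) ω = i then (1 : ℝ) else 0)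
          ∂P) := by
        have hw := fun i => hYw i (fun k => if k = i then 1 else 0) t
        rw [integral_finsetSum (f := fun i ω => Y i ω -
          Y i ω * (if S (arrival N p ω + s + t) ω = i then (1 : ℝ) else 0)) _
          fun i _ => (hYint i).sub (hw i)]
        exact Finset.sum_congr rfl fun i _ => integral_sub (hYint i) (hw i)
    _ = ∑ i, ∫ ω, Y i ω * (1 - NormedSpace.exp ((t : ℝ) • Q) i i) ∂P := by
        refine Finset.sum_congr rfl fun i _ => ?_
        have hw := hYw i (fun k => NormedSpace.exp ((t : ℝ) • Q) k i) 0
        simp only [add_zero] at hw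
        rw [integral_mul_strong_markov h p s t i (hY i) (hYb i) (hY0 i), ← integral_sub (hYint i) hw]
        refine integral_congr_ae (Eventually.of_forall fun ω => ?_)
        simp only [hYdef]
        split_ifs with h1
        · rw [h1]
          ring
        · ring
    _ = ∫ ω, ∑ i, Y i ω * (1 - NormedSpace.exp ((t : ℝ) • Q) i i) ∂P :=
        (integral_finsetSum _ fun i _ => (hYint i).mul_const _).symm
    _ ≤ ∫ _, C * t ∂P := by
        refine integral_mono (integrable_finsetSum _ fun i _ => (hYint i).mul_const _)
          (integrable_const _) fun ω => ?_
        simp only [hYdef]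
        rw [Finset.sum_eq_single (S (arrival N p ω + s) ω)]
        · rw [if_pos rfl, mul_one]
          have h2 := hbound t t.2 ht (S (arrival N p ω + s) ω)
          by_cases h3 : ω ∈ R
          · rw [Set.indicator_of_mem h3, one_mul]
            exact (le_abs_self _).trans h2
          · rw [Set.indicator_of_notMem h3, zero_mul]
            exact (abs_nonneg _).trans h2
        · intro i _ hi
          rw [if_neg (Ne.symm hi)]
          ring
        · exact fun h1 => (h1 (Finset.mem_univ _)).elim
    _ = C * t := by simp

end StrongMarkov

/-! ### The intensity between two events -/

section StepRate

variable {Ω : Type*} {M : ℕ} {μ : Fin M → ℝ} {φ : Fin M → ℝ → ℝ} {δ : ℝ}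
  {S : ℝ≥0 → Ω → Fin M} {N : ℝ≥0 → Ω → ℕ}

/-- The intensity attached to the state `i` on the `k`-th `δ`-step after `t_p`, the `i`-th diagonal
entry of `stepLambda μ φ δ N (p + 1) k`. -/
noncomputable def stepRate (μ : Fin M → ℝ) (φ : Fin M → ℝ → ℝ) (δ : ℝ) (N : ℝ≥0 → Ω → ℕ)
    (p k : ℕ) (i : Fin M) (ω : Ω) : ℝ :=
  μ i + ∑ l ∈ Finset.Icc 1 p, φ i ((arrival N p ω : ℝ) + k * δ - arrival N l ω)

lemma stepLambda_eq_diagonal (p k : ℕ) (ω : Ω) :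
    stepLambda μ φ δ N (p + 1) k ω = Matrix.diagonal fun i => stepRate μ φ δ N p k i ω := rfl

/-- Between `t_p` and the next event the intensity is constant on the `δ`-steps counted from
`t_p`. -/
lemma intensity_eq_stepRate (hN : IsCountingProcess N) {p k : ℕ} {ω : Ω} {r : ℝ≥0} (hr : 0 < r)
    (hp : N (arrival N p ω + r) ω = p) (hk : ⌊(r : ℝ) / δ⌋₊ = k) :
    intensity μ φ δ S N (arrival N p ω + r) ω
      = stepRate μ φ δ N p k (S (arrival N p ω + r) ω) ω := by
  classical
  have hreach : ∃ t, p ≤ N t ω := ⟨_, hp.ge⟩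
  have hlast : lastEvent N (arrival N p ω + r) ω = arrival N p ω := by rw [lastEvent, hp]
  have hsteps : elapsedSteps N δ (arrival N p ω + r) ω = k := by
    rw [elapsedSteps, hlast, NNReal.coe_add, add_sub_cancel_left, hk]
  have hstate : ∀ i, stateIntensity μ φ δ N i (arrival N p ω + r) ω
      = stepRate μ φ δ N p k i ω := by
    intro i
    rw [stateIntensity, hp, hlast, hsteps, stepRate]
    congr 1
    refine Finset.sum_congr rfl fun l hl => if_pos ?_
    exact (hN.arrival_mono (Finset.mem_Icc.1 hl).2 hreach).trans_lt (lt_add_of_pos_right _ hr)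
  rw [intensity, Finset.sum_eq_single (S (arrival N p ω + r) ω)]
  · rw [if_pos rfl, hstate]
  · exact fun i _ hi => if_neg (Ne.symm hi)
  · exact fun h1 => (h1 (Finset.mem_univ _)).elim

lemma stepRate_nonneg (hN : IsCountingProcess N) (hδ : 0 ≤ δ) (hμ : ∀ i, 0 ≤ μ i)
    (hφ : ∀ i t, 0 ≤ t → 0 ≤ φ i t) {p : ℕ} (k : ℕ) (i : Fin M) {ω : Ω}
    (hω : ∃ t, p ≤ N t ω) : 0 ≤ stepRate μ φ δ N p k i ω := by
  refine add_nonneg (hμ i) (Finset.sum_nonneg fun l hl => hφ i _ ?_)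
  have h1 : (arrival N l ω : ℝ) ≤ arrival N p ω :=
    NNReal.coe_le_coe.2 (hN.arrival_mono (Finset.mem_Icc.1 hl).2 hω)
  have h2 : 0 ≤ (k : ℝ) * δ := by positivity
  linarith

/-- If the count at `t_p + s` is still `p`, the only event `t_{k + 1}` in `(t_p + s, t_p + s + x]` up
to `t_{p + 1}` is `t_{p + 1}` itself, and it lies there if and only if the count changes. -/
lemma tsum_event_eq {p : ℕ} (hN : IsCountingProcess N) {ω : Ω} {s x : ℝ≥0}
    (hp : N (arrival N p ω + s) ω = p) (c : ℝ≥0 → ℝ≥0∞)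
    (hc : ∀ t, c t = open Classical in if arrival N p ω + s < t ∧ t ≤ arrival N p ω + s + x ∧
      (t : WithTop ℝ≥0) ≤ eventTime N (p + 1) ω then 1 else 0) :
    (∑' k : ℕ, open Classical in if ∃ t, k + 1 ≤ N t ω then c (arrival N (k + 1) ω) else 0)
      = if N (arrival N p ω + s + x) ω = p then 0 else 1 := by
  classical
  have hreach : ∃ t, p ≤ N t ω := ⟨_, hp.ge⟩
  rw [tsum_eq_single p]
  · by_cases hx : N (arrival N p ω + s + x) ω = p
    · rw [if_pos hx]
      split_ifs with h1
      · rw [hc, if_neg]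
        rintro ⟨_, h2, _⟩
        have := (hN.arrival_le_iff h1 _).1 h2
        omega
      · rfl
    · rw [if_neg hx]
      have h0 : N (arrival N p ω + s) ω ≤ N (arrival N p ω + s + x) ω :=
        hN.mono ω le_self_add
      have h1 : p + 1 ≤ N (arrival N p ω + s + x) ω := by omega
      have h2 : ∃ t, p + 1 ≤ N t ω := ⟨_, h1⟩
      rw [if_pos h2, hc, if_pos]
      refine ⟨?_, (hN.arrival_le_iff h2 _).2 h1, (eventTime_eq_arrival h2).ge⟩
      by_contra! h3
      have := (hN.arrival_le_iff h2 _).1 h3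
      omega
  · intro k hk
    split_ifs with h1
    · rw [hc, if_neg]
      rintro ⟨h2, _, h3⟩
      rcases lt_or_gt_of_ne hk with h4 | h4
      · have h5 := hN.arrival_mono (show k + 1 ≤ p by omega) hreach
        exact absurd (h2.trans_le h5) (not_lt.2 le_self_add)
      · have h5 : ∃ t, p + 1 + 1 ≤ N t ω := h1.imp fun t ht => by omega
        have h6 : ∃ t, p + 1 ≤ N t ω := h1.imp fun t ht => by omega
        rw [eventTime_eq_arrival h6, WithTop.coe_le_coe] at h3
        have h7 := hN.arrival_lt_arrival_succ h5
        have h8 := hN.arrival_mono (show p + 1 + 1 ≤ k + 1 by omega) h1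
        exact absurd (h7.trans_le h8) (not_lt.2 h3)
    · rfl

end StepRate

section Intensity

open Filter Topology

variable {Ω : Type*} [mΩ : MeasurableSpace Ω] {M : ℕ} {P : Measure Ω}
  {Q : Matrix (Fin M) (Fin M) ℝ} {μ : Fin M → ℝ}
  {φ : Fin M → ℝ → ℝ} {δ : ℝ} {S : ℝ≥0 → Ω → Fin M} {N : ℝ≥0 → Ω → ℕ}

lemma measurable_stepRate (h : IsMMHPDelta P Q μ φ δ S N) (p k : ℕ) (i : Fin M) (s : ℝ≥0) :
    Measurable[histAt h p s] (stepRate μ φ δ N p k i) := by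
  refine Measurable.mono ?_ (histAt_mono h p (zero_le : 0 ≤ s)) le_rfl
  refine measurable_const.add (Finset.measurable_sum _ fun l hl => ?_)
  refine (h.kernel_measurable i).comp ?_
  exact ((measurable_coe_nnreal_real.comp (measurable_arrival_le h le_rfl)).add_const _).sub
    (measurable_coe_nnreal_real.comp (measurable_arrival_le h (Finset.mem_Icc.1 hl).2))

/-- The intensity at `t_p + t` before the next event, on the `k`-th `δ`-step, and `0` after it. -/
noncomputable def killRate (μ : Fin M → ℝ) (φ : Fin M → ℝ → ℝ) (δ : ℝ) (S : ℝ≥0 → Ω → Fin M)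
    (N : ℝ≥0 → Ω → ℕ) (p k : ℕ) (ω : Ω) (t : ℝ≥0) : ℝ :=
  if N (arrival N p ω + t) ω = p then stepRate μ φ δ N p k (S (arrival N p ω + t) ω) ω else 0

lemma measurable_killRate (h : IsMMHPDelta P Q μ φ δ S N) (p k : ℕ) :
    Measurable fun q : Ω × ℝ≥0 => killRate μ φ δ S N p k q.1 q.2 := by
  have ht : Measurable fun q : Ω × ℝ≥0 => (arrival N p q.1 + q.2, q.1) :=
    (((measurable_arrival h p).comp measurable_fst).add measurable_snd).prodMk measurable_fst
  have h1 := (measurable_uncurry_of_rightCts h.measurable_counting h.counting.rightCts).comp ht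
  have h2 := (measurable_uncurry_of_rightCts h.measurable_chain h.chain_rightCts).comp ht
  have h3 : Measurable fun q : Fin M × Ω => stepRate μ φ δ N p k q.1 q.2 :=
    measurable_from_prod_countable_right fun i =>
      (measurable_stepRate h p k i 0).mono (histAt_le h p 0) le_rfl
  exact Measurable.ite (h1 (measurableSet_singleton p)) (h3.comp (h2.prodMk measurable_fst))
    measurable_const

/-- The intensity of the enlarged history, read on the interval `(t_p + s, t_p + s + x]`: the
probability that an event occurs there is the expected integral of the rate until that event. -/
lemma measure_event_eq_lintegral (h : IsMMHPDelta P Q μ φ δ S N) {p k : ℕ} {s x : ℝ≥0}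
    (hs : k * δ ≤ s) (hx : (s : ℝ) + x ≤ (k + 1) * δ) {B : Set Ω}
    (hB : MeasurableSet[fullAt h p s] B) (hBp : ∀ ω ∈ B, N (arrival N p ω + s) ω = p) :
    ∫⁻ ω in B, (if N (arrival N p ω + s + x) ω = p then 0 else 1) ∂P
      = ∫⁻ ω in B, (∫⁻ r in Set.Ioc (0 : ℝ) x,
          ENNReal.ofReal (killRate μ φ δ S N p k ω (s + r.toNNReal))) ∂P := by
  classical
  have hδ := h.step_pos
  have hBm : MeasurableSet B := fullAt_le h p s _ hB
  have hreach : ∀ ω ∈ B, ∃ t, p ≤ N t ω := fun ω hω => ⟨_, (hBp ω hω).ge⟩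
  set D : Set (ℝ≥0 × Ω) := ({q | q.2 ∈ B ∧ timeAfter N (p + 1) s q.2 < q.1} \
    {q | q.2 ∈ Set.univ ∧ timeAfter N (p + 1) (s + x) q.2 < q.1}) \
    {q | q.2 ∈ Set.univ ∧ timeAfter N (p + 1 + 1) 0 q.2 < q.1} with hD
  have hDm : MeasurableSet[(fullHistory h).predictable] D :=
    MeasurableSet.diff (MeasurableSet.diff
      (measurableSet_predictable_stoppingTime_lt (stoppingTime_full h p s) hB)
      (measurableSet_predictable_stoppingTime_lt (stoppingTime_full h p (s + x))
        MeasurableSet.univ))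
      (measurableSet_predictable_stoppingTime_lt (stoppingTime_full h (p + 1) 0)
        MeasurableSet.univ)
  have hDB : ∀ ω ∈ B, ∀ t, (t, ω) ∈ D ↔ arrival N p ω + s < t ∧ t ≤ arrival N p ω + s + x ∧
      (t : WithTop ℝ≥0) ≤ eventTime N (p + 1) ω := by
    intro ω hω t
    have h1 : timeAfter N (p + 1 + 1) 0 ω = eventTime N (p + 1) ω := by
      change eventTime N (p + 1) ω + _ = _
      simp
    simp only [hD, Set.mem_sdiff, Set.mem_ofPred_eq, Set.mem_univ, true_and, h1,
      timeAfter_eq_coe (hreach ω hω), WithTop.coe_lt_coe, not_lt, hω, ← add_assoc, and_assoc]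
  have hDnB : ∀ ω ∉ B, ∀ t, (t, ω) ∉ D := fun ω hω t ht => hω ht.1.1.1
  have hmain := h.has_intensity (D.indicator fun _ => 1)
    (Measurable.indicator (@measurable_const _ _ _ (fullHistory h).predictable _) hDm)
  have hL : (∫⁻ ω, ∑' k : ℕ, (if ∃ t, k + 1 ≤ N t ω then
        D.indicator (fun _ => (1 : ℝ≥0∞)) (arrival N (k + 1) ω, ω) else 0) ∂P)
      = ∫⁻ ω in B, (if N (arrival N p ω + s + x) ω = p then 0 else 1) ∂P := by
    rw [← lintegral_indicator hBm]
    refine lintegral_congr fun ω => ?_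
    by_cases hω : ω ∈ B
    · rw [Set.indicator_of_mem hω]
      refine tsum_event_eq h.counting (hBp ω hω)
        (fun t => D.indicator (fun _ => (1 : ℝ≥0∞)) (t, ω)) fun t => ?_
      simp only [Set.indicator_apply, hDB ω hω]
    · rw [Set.indicator_of_notMem hω]
      simp [Set.indicator_of_notMem (hDnB ω hω _)]
  have hR : (∫⁻ ω, (∫⁻ t in Set.Ici (0 : ℝ), D.indicator (fun _ => (1 : ℝ≥0∞)) (t.toNNReal, ω) *
        ENNReal.ofReal (intensity μ φ δ S N t.toNNReal ω)) ∂P)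
      = ∫⁻ ω in B, (∫⁻ r in Set.Ioc (0 : ℝ) x,
          ENNReal.ofReal (killRate μ φ δ S N p k ω (s + r.toNNReal))) ∂P := by
    rw [← lintegral_indicator hBm]
    refine lintegral_congr fun ω => ?_
    by_cases hω : ω ∈ B
    swap
    · rw [Set.indicator_of_notMem hω]
      simp [Set.indicator_of_notMem (hDnB ω hω _)]
    rw [Set.indicator_of_mem hω, ← lintegral_indicator measurableSet_Ici,
      ← lintegral_indicator measurableSet_Ioc,
      ← lintegral_add_left_eq_self _ (((arrival N p ω + s : ℝ≥0) : ℝ))]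
    -- the time of the next event and the end of the interval are negligible
    have hne : ∀ᵐ r : ℝ, r ≠ x ∧ r ≠ (arrival N (p + 1) ω : ℝ) - (arrival N p ω + s : ℝ≥0) := by
      have hnull : ∀ a : ℝ, ∀ᵐ r : ℝ, r ≠ a := fun a => by simp [ae_iff]
      exact (hnull _).and (hnull _)
    refine lintegral_congr_ae ?_
    filter_upwards [hne] with r hr
    obtain ⟨hrx, hre⟩ := hr
    by_cases hr0 : 0 < r ∧ r < x
    · obtain ⟨hr0, hrx'⟩ := hr0
      have hmem : ((arrival N p ω + s : ℝ≥0) : ℝ) + r ∈ Set.Ici (0 : ℝ) :=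
        Set.mem_Ici.2 (by positivity)
      have hnn : (((arrival N p ω + s : ℝ≥0) : ℝ) + r).toNNReal
          = arrival N p ω + (s + r.toNNReal) := by
        rw [Real.toNNReal_add (NNReal.coe_nonneg _) hr0.le, Real.toNNReal_coe, add_assoc]
      have hrpos : 0 < r.toNNReal := Real.toNNReal_pos.2 hr0
      have hrc : ((r.toNNReal : ℝ≥0) : ℝ) = r := Real.coe_toNNReal r hr0.le
      rw [Set.indicator_of_mem hmem, Set.indicator_of_mem (Set.mem_Ioc.2 ⟨hr0, hrx'.le⟩), hnn,
        killRate]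
      have hge : p ≤ N (arrival N p ω + (s + r.toNNReal)) ω := by
        rw [← hBp ω hω]
        refine h.counting.mono ω ?_
        rw [← add_assoc, hBp ω hω]
        exact le_self_add
      have hDr : (arrival N p ω + (s + r.toNNReal), ω) ∈ D ↔
          N (arrival N p ω + (s + r.toNNReal)) ω = p := by
        rw [hDB ω hω, ← add_assoc]
        have h1 : arrival N p ω + s < arrival N p ω + s + r.toNNReal :=
          lt_add_of_pos_right _ hrpos
        have h2 : arrival N p ω + s + r.toNNReal ≤ arrival N p ω + s + x := by
          gcongr
          exact Real.toNNReal_le_iff_le_coe.2 hrx'.le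
        simp only [h1, h2, true_and]
        rw [← add_assoc] at hge
        by_cases hev : ∃ t, p + 1 ≤ N t ω
        · rw [eventTime_eq_arrival hev, WithTop.coe_le_coe]
          have h3 : arrival N p ω + s + r.toNNReal ≠ arrival N (p + 1) ω := by
            intro h4
            refine hre ?_
            rw [← h4, NNReal.coe_add (arrival N p ω + s), hrc]
            ring
          rw [← not_iff_not, not_le]
          have h5 : arrival N (p + 1) ω < arrival N p ω + s + r.toNNReal ↔
              arrival N (p + 1) ω ≤ arrival N p ω + s + r.toNNReal :=
            ⟨le_of_lt, fun h6 => lt_of_le_of_ne h6 h3.symm⟩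
          rw [h5, h.counting.arrival_le_iff hev]
          omega
        · have h6 : eventTime N (p + 1) ω = ⊤ := by
            rwa [← eventTime_ne_top_iff, not_not] at hev
          rw [h6]
          refine iff_of_true le_top ?_
          by_contra h7
          exact hev ⟨arrival N p ω + s + r.toNNReal, by omega⟩
      by_cases hNp : N (arrival N p ω + (s + r.toNNReal)) ω = p
      · rw [Set.indicator_of_mem (hDr.2 hNp), one_mul, if_pos hNp,
          intensity_eq_stepRate h.counting (add_pos_of_nonneg_of_pos zero_le hrpos) hNp]
        rw [NNReal.coe_add, hrc, Nat.floor_eq_iff (by positivity), le_div_iff₀ hδ, div_lt_iff₀ hδ]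
        constructor <;> linarith
      · rw [Set.indicator_of_notMem (fun h8 => hNp (hDr.1 h8)), zero_mul, if_neg hNp,
          ENNReal.ofReal_zero]
    · have h1 : r ∉ Set.Ioc (0 : ℝ) x := fun h2 => hr0 ⟨h2.1, lt_of_le_of_ne h2.2 hrx⟩
      rw [Set.indicator_of_notMem h1]
      refine Set.indicator_apply_eq_zero.2 fun hmem => ?_
      rw [Set.indicator_of_notMem, zero_mul]
      intro h2
      rw [hDB ω hω] at h2
      obtain ⟨h3, h4, _⟩ := h2
      have hmem' := Set.mem_Ici.1 hmem
      rw [Real.lt_toNNReal_iff_coe_lt] at h3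
      rw [Real.toNNReal_le_iff_le_coe, NNReal.coe_add (arrival N p ω + s)] at h4
      exact h1 ⟨by linarith, by linarith⟩
  rw [← hL, ← hR]
  exact hmain

end Intensity

/-! ### First-order expansion of the probability of an event -/

section AliveBdd

variable {Ω : Type*} {M : ℕ} {μ : Fin M → ℝ} {φ : Fin M → ℝ → ℝ} {δ : ℝ}
  {S : ℝ≥0 → Ω → Fin M} {N : ℝ≥0 → Ω → ℕ}

/-- The event that `N` is still at `p` at time `t_p + s` and that the rates of the `k`-th `δ`-step are
at most `K`. -/
def aliveBdd (μ : Fin M → ℝ) (φ : Fin M → ℝ → ℝ) (δ : ℝ) (N : ℝ≥0 → Ω → ℕ) (p k : ℕ) (K : ℝ)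
    (s : ℝ≥0) : Set Ω :=
  {ω | N (arrival N p ω + s) ω = p ∧ ∀ i, |stepRate μ φ δ N p k i ω| ≤ K}

lemma abs_killRate_le {p k : ℕ} {K : ℝ} (hK : 0 ≤ K) {s : ℝ≥0} {ω : Ω}
    (hω : ω ∈ aliveBdd μ φ δ N p k K s) (t : ℝ≥0) : |killRate μ φ δ S N p k ω t| ≤ K := by
  rw [killRate]
  split_ifs
  · exact hω.2 _
  · simpa using hK

/-- The integral of the rate from `t_p + s` to `t_p + s + x` or to the next event. -/
noncomputable def killIntegral (μ : Fin M → ℝ) (φ : Fin M → ℝ → ℝ) (δ : ℝ) (S : ℝ≥0 → Ω → Fin M)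
    (N : ℝ≥0 → Ω → ℕ) (p k : ℕ) (s x : ℝ≥0) (ω : Ω) : ℝ :=
  ∫ r in Set.Ioc (0 : ℝ) x, killRate μ φ δ S N p k ω (s + r.toNNReal)

lemma abs_killIntegral_le {p k : ℕ} {K : ℝ} (hK : 0 ≤ K) {s : ℝ≥0} {ω : Ω}
    (hω : ω ∈ aliveBdd μ φ δ N p k K s) (s' x : ℝ≥0) :
    |killIntegral μ φ δ S N p k s' x ω| ≤ K * x := by
  have h1 := norm_setIntegral_le_of_norm_le_const (μ := volume) (s := Set.Ioc (0 : ℝ) x) (C := K)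
    (f := fun r : ℝ => killRate μ φ δ S N p k ω (s' + r.toNNReal)) (by simp)
    (fun r _ => abs_killRate_le hK hω _)
  simpa [killIntegral] using h1

end AliveBdd

section Kill

open Filter Topology

variable {Ω : Type*} [mΩ : MeasurableSpace Ω] {M : ℕ} {P : Measure Ω}
  {Q : Matrix (Fin M) (Fin M) ℝ} {μ : Fin M → ℝ}
  {φ : Fin M → ℝ → ℝ} {δ : ℝ} {S : ℝ≥0 → Ω → Fin M} {N : ℝ≥0 → Ω → ℕ}

lemma measurableSet_aliveBdd (h : IsMMHPDelta P Q μ φ δ S N) (p k : ℕ) (K : ℝ) (s : ℝ≥0) :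
    MeasurableSet[histAt h p s] (aliveBdd μ φ δ N p k K s) := by
  have h2 : ∀ i, MeasurableSet[histAt h p s] {ω | |stepRate μ φ δ N p k i ω| ≤ K} := fun i =>
    (continuous_abs.measurable.comp (measurable_stepRate h p k i s)) measurableSet_Iic
  have h3 : aliveBdd μ φ δ N p k K s = (fun ω => N (arrival N p ω + s) ω) ⁻¹' {p} ∩
      ⋂ i, {ω | |stepRate μ φ δ N p k i ω| ≤ K} := by
    ext ω
    simp [aliveBdd]
  rw [h3]
  exact (measurable_counting_at h p s (measurableSet_singleton p)).inter (MeasurableSet.iInter h2)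

lemma measurable_killRate_toNNReal (h : IsMMHPDelta P Q μ φ δ S N) (p k : ℕ) (s : ℝ≥0) :
    Measurable fun q : Ω × ℝ => killRate μ φ δ S N p k q.1 (s + q.2.toNNReal) :=
  (measurable_killRate h p k).comp
    (measurable_fst.prodMk ((measurable_real_toNNReal.comp measurable_snd).const_add s))

lemma integrableOn_killRate (h : IsMMHPDelta P Q μ φ δ S N) {p k : ℕ} {K : ℝ} (hK : 0 ≤ K)
    {s : ℝ≥0} {ω : Ω} (hω : ω ∈ aliveBdd μ φ δ N p k K s) (s' x : ℝ≥0) :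
    IntegrableOn (fun r : ℝ => killRate μ φ δ S N p k ω (s' + r.toNNReal))
      (Set.Ioc (0 : ℝ) x) := by
  refine Integrable.of_bound ?_ K (Eventually.of_forall fun r => abs_killRate_le hK hω _)
  exact ((measurable_killRate_toNNReal h p k s').comp measurable_prodMk_left).aestronglyMeasurable

lemma measurable_killIntegral (h : IsMMHPDelta P Q μ φ δ S N) (p k : ℕ) (s x : ℝ≥0) :
    Measurable (killIntegral μ φ δ S N p k s x) :=
  ((measurable_killRate_toNNReal h p k s).stronglyMeasurable.integral_prod_right
    (ν := volume.restrict (Set.Ioc (0 : ℝ) x))).measurable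

lemma measurable_event (h : IsMMHPDelta P Q μ φ δ S N) (p : ℕ) (s x : ℝ≥0) :
    Measurable fun ω => if N (arrival N p ω + s + x) ω = p then (0 : ℝ) else 1 :=
  (measurable_of_countable fun k : ℕ => if k = p then (0 : ℝ) else 1).comp
    (measurable_counting_comp h (((measurable_arrival h p).add_const s).add_const x))

/-- Up to the next event and as long as the chain does not move, the rate is constant. -/
lemma abs_killIntegral_sub_le (h : IsMMHPDelta P Q μ φ δ S N) {p k : ℕ} {K : ℝ} (hK : 0 ≤ K)
    {s x : ℝ≥0} {ω : Ω} (hω : ω ∈ aliveBdd μ φ δ N p k K s) :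
    |killIntegral μ φ δ S N p k s x ω
        - x * stepRate μ φ δ N p k (S (arrival N p ω + s + x) ω) ω|
      ≤ K * x * (if N (arrival N p ω + s + x) ω = p then 0 else 1)
        + 2 * K * ∫ r in Set.Ioc (0 : ℝ) x,
          (if S (arrival N p ω + (s + r.toNNReal)) ω = S (arrival N p ω + s + x) ω
            then 0 else 1) := by
  set i := S (arrival N p ω + s + x) ω with hi
  set U : ℝ := if N (arrival N p ω + s + x) ω = p then 0 else 1 with hU
  have hm : Measurable fun r : ℝ =>
      if S (arrival N p ω + (s + r.toNNReal)) ω = i then (0 : ℝ) else 1 := by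
    have h1 : Measurable fun r : ℝ => S (arrival N p ω + (s + r.toNNReal)) ω :=
      ((measurable_uncurry_of_rightCts h.measurable_chain h.chain_rightCts).comp
        measurable_prodMk_right).comp ((measurable_real_toNNReal.const_add s).const_add _)
    exact (measurable_of_countable fun k : Fin M => if k = i then (0 : ℝ) else 1).comp h1
  have hint : IntegrableOn (fun r : ℝ =>
      if S (arrival N p ω + (s + r.toNNReal)) ω = i then (0 : ℝ) else 1) (Set.Ioc (0 : ℝ) x) :=
    Integrable.of_bound hm.aestronglyMeasurable 1
      (Eventually.of_forall fun ω => by split_ifs <;> simp)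
  have hc : ∀ c : ℝ, ∫ _ in Set.Ioc (0 : ℝ) x, c = x * c := fun c => by simp
  have h1 : killIntegral μ φ δ S N p k s x ω - x * stepRate μ φ δ N p k i ω
      = ∫ r in Set.Ioc (0 : ℝ) x, (killRate μ φ δ S N p k ω (s + r.toNNReal)
        - stepRate μ φ δ N p k i ω) := by
    rw [integral_sub (integrableOn_killRate h hK hω s x) (integrable_const _), hc]
    rfl
  have h2 : K * x * U + 2 * K * ∫ r in Set.Ioc (0 : ℝ) x,
        (if S (arrival N p ω + (s + r.toNNReal)) ω = i then (0 : ℝ) else 1)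
      = ∫ r in Set.Ioc (0 : ℝ) x, (K * U + 2 * K *
        (if S (arrival N p ω + (s + r.toNNReal)) ω = i then (0 : ℝ) else 1)) := by
    rw [integral_add (integrable_const _) (hint.const_mul _), hc, integral_const_mul]
    ring
  rw [h1, h2, ← Real.norm_eq_abs]
  refine norm_integral_le_of_norm_le ((integrable_const _).add (hint.const_mul _)) ?_
  refine (ae_restrict_iff' measurableSet_Ioc).2 (Eventually.of_forall fun r hr => ?_)
  have hrx : r.toNNReal ≤ x := Real.toNNReal_le_iff_le_coe.2 hr.2
  rw [Real.norm_eq_abs, killRate]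
  have hb := fun j => abs_le.1 (hω.2 j)
  by_cases hN : N (arrival N p ω + (s + r.toNNReal)) ω = p
  · rw [if_pos hN]
    have hU0 : 0 ≤ U := by
      rw [hU]
      split_ifs <;> simp
    by_cases hS : S (arrival N p ω + (s + r.toNNReal)) ω = i
    · rw [if_pos hS, hS, sub_self, abs_zero]
      positivity
    · rw [if_neg hS]
      have := mul_nonneg hK hU0
      rw [abs_le]
      constructor <;> linarith [(hb i).1, (hb i).2,
        (hb (S (arrival N p ω + (s + r.toNNReal)) ω)).1,
        (hb (S (arrival N p ω + (s + r.toNNReal)) ω)).2]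
  · rw [if_neg hN, zero_sub, abs_neg]
    -- an event before `t_p + s + r` is one before `t_p + s + x`
    have hU1 : U = 1 := by
      rw [hU, if_neg]
      intro h3
      refine hN (le_antisymm ?_ ?_)
      · refine (h.counting.mono ω ?_).trans h3.le
        rw [add_assoc]
        gcongr
      · refine hω.1.ge.trans (h.counting.mono ω ?_)
        gcongr
        exact le_self_add
    rw [hU1]
    have : 0 ≤ 2 * K * (if S (arrival N p ω + (s + r.toNNReal)) ω = i then (0 : ℝ) else 1) := by
      split_ifs <;> simp [hK]
    linarith [hω.2 i]

variable [IsProbabilityMeasure P]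

lemma integrable_aliveBdd_killIntegral (h : IsMMHPDelta P Q μ φ δ S N) {p k : ℕ} {K : ℝ}
    (hK : 0 ≤ K) (s x : ℝ≥0) :
    IntegrableOn (killIntegral μ φ δ S N p k s x) (aliveBdd μ φ δ N p k K s) P := by
  refine Integrable.of_bound (measurable_killIntegral h p k s x).aestronglyMeasurable (K * x) ?_
  refine (ae_restrict_iff' (histAt_le h p s _ (measurableSet_aliveBdd h p k K s))).2
    (Eventually.of_forall fun ω hω => abs_killIntegral_le hK hω s x)

lemma integrable_event (h : IsMMHPDelta P Q μ φ δ S N) (p : ℕ) (s x : ℝ≥0) :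
    Integrable (fun ω => if N (arrival N p ω + s + x) ω = p then (0 : ℝ) else 1) P :=
  Integrable.of_bound (measurable_event h p s x).aestronglyMeasurable 1
    (Eventually.of_forall fun ω => by split_ifs <;> simp)

lemma setIntegral_event_eq (h : IsMMHPDelta P Q μ φ δ S N) {p k : ℕ} {K : ℝ} (hK : 0 ≤ K)
    {s x : ℝ≥0} (hs : k * δ ≤ s) (hx : (s : ℝ) + x ≤ (k + 1) * δ) {B : Set Ω}
    (hB : MeasurableSet[fullAt h p s] B) (hBA : B ⊆ aliveBdd μ φ δ N p k K s) :
    ∫ ω in B, (if N (arrival N p ω + s + x) ω = p then (0 : ℝ) else 1) ∂P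
      = ∫ ω in B, killIntegral μ φ δ S N p k s x ω ∂P := by
  have hBm : MeasurableSet B := fullAt_le h p s _ hB
  have hnn : ∀ ω ∈ B, ∀ t, 0 ≤ killRate μ φ δ S N p k ω t := by
    intro ω hω t
    rw [killRate]
    split_ifs with h1
    · exact stepRate_nonneg h.counting h.step_pos.le h.baseline_nonneg h.kernel_nonneg k _
        ⟨_, h1.ge⟩
    · exact le_rfl
  have hmain := measure_event_eq_lintegral h hs hx hB fun ω hω => (hBA hω).1
  rw [integral_eq_lintegral_of_nonneg_ae (Eventually.of_forall fun ω => ?_)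
      (integrable_event h p s x).integrableOn.aestronglyMeasurable,
    integral_eq_lintegral_of_nonneg_ae ?_
      (measurable_killIntegral h p k s x).aestronglyMeasurable]
  · congr 1
    refine Eq.trans ?_ (hmain.trans ?_)
    · refine lintegral_congr fun ω => ?_
      split_ifs <;> simp
    · refine setLIntegral_congr_fun hBm fun ω hω => ?_
      exact (ofReal_integral_eq_lintegral_ofReal (integrableOn_killRate h hK (hBA hω) s x)
        (Eventually.of_forall fun r => hnn ω hω _)).symm
  · exact (ae_restrict_iff' hBm).2 (Eventually.of_forall fun ω hω =>
      integral_nonneg fun r => hnn ω hω _)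
  · change (0 : ℝ) ≤ ite _ _ _
    split_ifs <;> simp

/-- To first order in `x`, the probability of an event in `(t_p + s, t_p + s + x]`, given the path of
the chain, is `x` times the rate of the state at the end of the interval. -/
lemma exists_kill_bound (h : IsMMHPDelta P Q μ φ δ S N) (p k : ℕ) {K : ℝ} (hK : 0 ≤ K) :
    ∃ C, 0 ≤ C ∧ ∀ s x : ℝ≥0, k * δ ≤ s → (s : ℝ) + x ≤ (k + 1) * δ → (x : ℝ) ≤ 1 →
      ∀ Z : Ω → ℝ, Measurable[fullAt h p s] Z → ∀ b, (∀ ω, |Z ω| ≤ b) →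
      (∀ ω, ω ∉ aliveBdd μ φ δ N p k K s → Z ω = 0) →
      |∫ ω, Z ω * (if N (arrival N p ω + s + x) ω = p then 0 else 1) ∂P
        - ∫ ω, Z ω * (x * stepRate μ φ δ N p k (S (arrival N p ω + s + x) ω) ω) ∂P|
        ≤ b * C * x ^ 2 := by
  obtain ⟨C₀, hC₀, hmove⟩ := exists_chain_move_bound h p
  refine ⟨K ^ 2 + 2 * K * C₀, by positivity, fun s x hs hx hx1 Z hZ b hb hZ0 => ?_⟩
  have hb0 : 0 ≤ b := by
    obtain ⟨ω⟩ : Nonempty Ω := P.nonempty_of_neZero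
    exact (abs_nonneg _).trans (hb ω)
  set A := aliveBdd μ φ δ N p k K s with hA
  have hAf : MeasurableSet[fullAt h p s] A :=
    jointAt_le_fullAt h p s _ (histAt_le_jointAt h p s _ (measurableSet_aliveBdd h p k K s))
  have hAm : MeasurableSet A := fullAt_le h p s _ hAf
  set R : Set Ω := {ω | ∃ t, p ≤ N t ω} with hR
  have hRm : MeasurableSet R := histAt_le h p s _ (measurableSet_reach h p s)
  have hZm : Measurable Z := hZ.mono (fullAt_le h p s) le_rfl
  set U : Ω → ℝ := fun ω => if N (arrival N p ω + s + x) ω = p then 0 else 1 with hU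
  set F : Ω → ℝ → ℝ := fun ω r => R.indicator (fun _ => (1 : ℝ)) ω *
    (if S (arrival N p ω + (s + r.toNNReal)) ω = S (arrival N p ω + s + x) ω
      then 0 else 1) with hF
  have hFm : Measurable (Function.uncurry F) := by
    have ha : Measurable fun q : Ω × ℝ => arrival N p q.1 :=
      (measurable_arrival h p).comp measurable_fst
    have hu := measurable_uncurry_of_rightCts h.measurable_chain h.chain_rightCts
    have h1 : Measurable fun q : Ω × ℝ => S (arrival N p q.1 + (s + q.2.toNNReal)) q.1 :=
      hu.comp ((ha.add ((measurable_real_toNNReal.comp measurable_snd).const_add s)).prodMk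
        measurable_fst)
    have h2 : Measurable fun q : Ω × ℝ => S (arrival N p q.1 + s + x) q.1 :=
      hu.comp (((ha.add_const s).add_const x).prodMk measurable_fst)
    exact ((measurable_const.indicator hRm).comp measurable_fst).mul
      (Measurable.ite (measurableSet_eq_fun h1 h2) measurable_const measurable_const)
  have hF01 : ∀ ω r, 0 ≤ F ω r ∧ F ω r ≤ 1 := by
    intro ω r
    simp only [hF]
    by_cases hω : ω ∈ R
    · rw [Set.indicator_of_mem hω]
      split_ifs <;> simp
    · simp [Set.indicator_of_notMem hω]
  have hFb : ∀ ω r, ‖F ω r‖ ≤ 1 := fun ω r => by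
    rw [Real.norm_eq_abs, abs_of_nonneg (hF01 ω r).1]
    exact (hF01 ω r).2
  set J : Ω → ℝ := fun ω => ∫ r in Set.Ioc (0 : ℝ) x, F ω r with hJ
  have hFint : Integrable (Function.uncurry F) (P.prod (volume.restrict (Set.Ioc (0 : ℝ) x))) :=
    Integrable.of_bound hFm.aestronglyMeasurable 1 (Eventually.of_forall fun q => hFb q.1 q.2)
  have hJint : Integrable J P := hFint.integral_prod_left
  have hJ0 : ∀ ω, 0 ≤ J ω := fun ω => integral_nonneg fun r => (hF01 ω r).1
  -- the chain moves between `t_p + s + r` and `t_p + s + x` with probability `O(x)`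
  have hJle : ∫ ω, J ω ∂P ≤ C₀ * x ^ 2 := by
    have hswap : ∫ ω, J ω ∂P = ∫ r in Set.Ioc (0 : ℝ) x, ∫ ω, F ω r ∂P :=
      integral_integral_swap hFint
    have hr : ∀ r ∈ Set.Ioc (0 : ℝ) x, ‖∫ ω, F ω r ∂P‖ ≤ C₀ * x := by
      intro r hr
      rw [Real.norm_of_nonneg (integral_nonneg fun ω => (hF01 ω r).1)]
      have hrx : r.toNNReal ≤ x := Real.toNNReal_le_iff_le_coe.2 hr.2
      have hle : ((x - r.toNNReal : ℝ≥0) : ℝ) ≤ x := NNReal.coe_le_coe.2 tsub_le_self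
      have h1 := hmove (s + r.toNNReal) (x - r.toNNReal) (hle.trans hx1)
      have h2 : ∀ ω, arrival N p ω + (s + r.toNNReal) + (x - r.toNNReal)
          = arrival N p ω + s + x := by
        intro ω
        rw [← add_assoc, add_assoc (arrival N p ω + s), add_tsub_cancel_of_le hrx]
      simp only [h2] at h1
      exact h1.trans (by gcongr)
    have h3 := norm_setIntegral_le_of_norm_le_const (μ := volume) (by simp) hr
    rw [hswap]
    refine (le_abs_self _).trans (h3.trans (le_of_eq ?_))
    simp
    ring
  have hUint : Integrable U P := integrable_event h p s x
  have hUle : ∫ ω in A, U ω ∂P ≤ K * x := by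
    rw [setIntegral_event_eq h hK hs hx hAf le_rfl]
    calc _ ≤ ∫ ω in A, K * x ∂P := by
          refine setIntegral_mono_on (integrable_aliveBdd_killIntegral h hK s x)
            (integrable_const _) hAm fun ω hω => ?_
          exact (le_abs_self _).trans (abs_killIntegral_le hK hω s x)
      _ ≤ K * x := by
          rw [setIntegral_const, smul_eq_mul]
          exact mul_le_of_le_one_left (by positivity) measureReal_le_one
  have hkey : ∫ ω, Z ω * U ω ∂P = ∫ ω, Z ω * killIntegral μ φ δ S N p k s x ω ∂P :=
    integral_mul_eq_of_setIntegral_eq (fullAt_le h p s) hAf hUint.integrableOn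
      (integrable_aliveBdd_killIntegral h hK s x)
      (fun B hB hBA => setIntegral_event_eq h hK hs hx hB hBA) hZ hb hZ0
  set G : Ω → ℝ := fun ω => x * stepRate μ φ δ N p k (S (arrival N p ω + s + x) ω) ω with hG
  have hGm : Measurable G := by
    have h3 : Measurable fun q : Fin M × Ω => stepRate μ φ δ N p k q.1 q.2 :=
      measurable_from_prod_countable_right fun i =>
        (measurable_stepRate h p k i 0).mono (histAt_le h p 0) le_rfl
    exact (h3.comp ((measurable_chain_comp h
      (((measurable_arrival h p).add_const s).add_const x)).prodMk measurable_id)).const_mul _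
  have hi1 : Integrable (fun ω => Z ω * killIntegral μ φ δ S N p k s x ω) P := by
    refine Integrable.of_bound (hZm.mul (measurable_killIntegral h p k s x)).aestronglyMeasurable
      (b * (K * x)) (Eventually.of_forall fun ω => ?_)
    by_cases hω : ω ∈ A
    · rw [norm_mul]
      exact mul_le_mul (hb ω) (abs_killIntegral_le hK hω s x) (abs_nonneg _) hb0
    · rw [hZ0 ω hω, zero_mul, norm_zero]
      positivity
  have hi2 : Integrable (fun ω => Z ω * G ω) P := by
    refine Integrable.of_bound (hZm.mul hGm).aestronglyMeasurable
      (b * (x * K)) (Eventually.of_forall fun ω => ?_)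
    by_cases hω : ω ∈ A
    · rw [norm_mul, hG, norm_mul, Real.norm_of_nonneg (NNReal.coe_nonneg x)]
      have h1 := hb ω
      have h2 := hω.2 (S (arrival N p ω + s + x) ω)
      gcongr
      · exact h1
      · exact h2
    · rw [hZ0 ω hω, zero_mul, norm_zero]
      positivity
  have hAU : Integrable (A.indicator U) P := hUint.indicator hAm
  rw [hkey, ← integral_sub hi1 hi2, ← Real.norm_eq_abs]
  calc _ ≤ ∫ ω, b * (K * x * A.indicator U ω + 2 * K * J ω) ∂P := by
        refine norm_integral_le_of_norm_le
          (((hAU.const_mul _).add (hJint.const_mul _)).const_mul _)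
          (Eventually.of_forall fun ω => ?_)
        by_cases hω : ω ∈ A
        · rw [← mul_sub, norm_mul, Set.indicator_of_mem hω]
          have hωR : ω ∈ R := ⟨_, hω.1.ge⟩
          have h1 := abs_killIntegral_sub_le (S := S) (x := x) h hK hω
          have h2 : J ω = ∫ r in Set.Ioc (0 : ℝ) x,
              (if S (arrival N p ω + (s + r.toNNReal)) ω = S (arrival N p ω + s + x) ω
                then 0 else 1) := by
            simp only [hJ, hF, Set.indicator_of_mem hωR, one_mul]
          rw [← h2] at h1
          exact mul_le_mul (hb ω) h1 (abs_nonneg _) hb0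
        · rw [hZ0 ω hω, zero_mul, zero_mul, sub_zero, norm_zero, Set.indicator_of_notMem hω]
          have := hJ0 ω
          positivity
    _ = b * (K * x * ∫ ω in A, U ω ∂P + 2 * K * ∫ ω, J ω ∂P) := by
        rw [integral_const_mul, integral_add (hAU.const_mul _) (hJint.const_mul _),
          integral_const_mul, integral_const_mul, integral_indicator hAm]
    _ ≤ b * (K * x * (K * x) + 2 * K * (C₀ * x ^ 2)) := by gcongr
    _ = _ := by ring

end Kill

/-! ### The transition matrix within one step -/

section Quadratic

/-- A function whose increments over steps of length `x` are `O(x²)` is constant. -/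
lemma eq_of_abs_sub_le_sq {g : ℝ≥0 → ℝ} {a b : ℝ≥0} (hab : a ≤ b) {C : ℝ}
    (hg : ∀ s x : ℝ≥0, a ≤ s → s + x ≤ b → (x : ℝ) ≤ 1 → |g (s + x) - g s| ≤ C * x ^ 2) :
    g b = g a := by
  have hstep : ∀ m : ℕ, ((b - a : ℝ≥0) : ℝ) ≤ m + 1 →
      |g b - g a| ≤ C * ((b - a : ℝ≥0) : ℝ) ^ 2 * (1 / ((m : ℝ) + 1)) := by
    intro m hm
    set x : ℝ≥0 := (b - a) / (m + 1) with hx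
    have hmx : ((m : ℝ≥0) + 1) * x = b - a := by
      rw [hx]
      field_simp
    have hx1 : (x : ℝ) ≤ 1 := by
      rw [hx]
      push_cast
      rw [div_le_one (by positivity)]
      exact_mod_cast hm
    have hind : ∀ i : ℕ, i ≤ m + 1 → |g (a + i * x) - g a| ≤ i * (C * x ^ 2) := by
      intro i
      induction i with
      | zero => simp
      | succ i ih =>
        intro hi
        have h1 : a + (i * x : ℝ≥0) + x ≤ b := by
          calc a + (i * x : ℝ≥0) + x = a + ((i + 1 : ℕ) : ℝ≥0) * x := by push_cast; ring
            _ ≤ a + ((m + 1 : ℕ) : ℝ≥0) * x := by gcongr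
            _ = b := by
              push_cast
              rw [hmx, add_tsub_cancel_of_le hab]
        have h2 := hg (a + i * x) x le_self_add h1 hx1
        have h3 : a + ((i + 1 : ℕ) : ℝ≥0) * x = a + (i * x : ℝ≥0) + x := by push_cast; ring
        rw [h3]
        have h4 := abs_sub_le (g (a + i * x + x)) (g (a + i * x)) (g a)
        have h5 := ih (by omega)
        push_cast
        linarith
    have h6 := hind (m + 1) le_rfl
    have h7 : a + ((m + 1 : ℕ) : ℝ≥0) * x = b := by
      push_cast
      rw [hmx, add_tsub_cancel_of_le hab]
    rw [h7] at h6
    refine h6.trans (le_of_eq ?_)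
    rw [← hmx]
    push_cast
    field_simp
  have hlim : Filter.Tendsto (fun m : ℕ => C * ((b - a : ℝ≥0) : ℝ) ^ 2 * (1 / ((m : ℝ) + 1)))
      Filter.atTop (nhds 0) := by
    simpa using (tendsto_one_div_add_atTop_nhds_zero_nat (𝕜 := ℝ)).const_mul
      (C * ((b - a : ℝ≥0) : ℝ) ^ 2)
  have h0 : |g b - g a| ≤ 0 := by
    refine ge_of_tendsto hlim ?_
    filter_upwards [Filter.eventually_ge_atTop ⌈((b - a : ℝ≥0) : ℝ)⌉₊] with m hm
    refine hstep m ((Nat.le_ceil _).trans ?_)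
    have : ((⌈((b - a : ℝ≥0) : ℝ)⌉₊ : ℕ) : ℝ) ≤ m := by exact_mod_cast hm
    linarith
  exact sub_eq_zero.1 (abs_nonpos_iff.1 h0)

end Quadratic

section Step

open Filter Topology

variable {Ω : Type*} [mΩ : MeasurableSpace Ω] {M : ℕ} {P : Measure Ω}
  {Q : Matrix (Fin M) (Fin M) ℝ} {μ : Fin M → ℝ}
  {φ : Fin M → ℝ → ℝ} {δ : ℝ} {S : ℝ≥0 → Ω → Fin M} {N : ℝ≥0 → Ω → ℕ}

lemma measurable_state_ind (h : IsMMHPDelta P Q μ φ δ S N) (p : ℕ) (s x : ℝ≥0) (i : Fin M) :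
    Measurable[fullAt h p s]
      fun ω => if S (arrival N p ω + s + x) ω = i then (1 : ℝ) else 0 :=
  (measurable_of_countable fun k : Fin M => if k = i then (1 : ℝ) else 0).comp
    (measurable_chain_at_full h p s x)

/-- The matrix exponential of `Q` minus the rates, over a time `t` of the `k`-th `δ`-step. -/
noncomputable def stepExp (Q : Matrix (Fin M) (Fin M) ℝ) (μ : Fin M → ℝ) (φ : Fin M → ℝ → ℝ) (δ : ℝ)
    (N : ℝ≥0 → Ω → ℕ) (p k : ℕ) (t : ℝ) (ω : Ω) : Matrix (Fin M) (Fin M) ℝ :=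
  NormedSpace.exp (t • (Q - stepLambda μ φ δ N (p + 1) k ω))

lemma measurable_stepExp (h : IsMMHPDelta P Q μ φ δ S N) (p k : ℕ) (t : ℝ) (i j : Fin M) :
    Measurable[histAt h p 0] fun ω => stepExp Q μ φ δ N p k t ω i j := by
  have h1 : Measurable[histAt h p 0] fun ω => fun i => stepRate μ φ δ N p k i ω :=
    @measurable_pi_lambda _ _ _ (histAt h p 0) _ _ fun i => measurable_stepRate h p k i 0
  exact (continuous_exp_sub_diagonal Q t i j).measurable.comp h1

lemma measurable_apply_chain (h : IsMMHPDelta P Q μ φ δ S N) {p : ℕ}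
    {Φ : Ω → Matrix (Fin M) (Fin M) ℝ} (hΦ : ∀ i j, Measurable[histAt h p 0] fun ω => Φ ω i j)
    (s : ℝ≥0) (j : Fin M) :
    Measurable[jointAt h p s] fun ω => Φ ω (S (arrival N p ω + s) ω) j := by
  have hle : histAt h p 0 ≤ jointAt h p s :=
    (histAt_mono h p (zero_le : 0 ≤ s)).trans (histAt_le_jointAt h p s)
  have h1 : (fun ω => Φ ω (S (arrival N p ω + s) ω) j)
      = fun ω => ∑ i, (if S (arrival N p ω + s) ω = i then (1 : ℝ) else 0) * Φ ω i j := by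
    funext ω
    simp
  rw [h1]
  refine Finset.measurable_sum _ fun i _ => ?_
  exact ((measurable_of_countable fun k : Fin M => if k = i then (1 : ℝ) else 0).comp
    (measurable_chain_at h p s)).mul ((hΦ i j).mono hle le_rfl)

variable [IsProbabilityMeasure P]

lemma integrable_mul_of_bound {Y W : Ω → ℝ} (hY : Measurable Y) (hW : Measurable W) {b c : ℝ}
    (hb : ∀ ω, |Y ω| ≤ b) (hc : ∀ ω, |W ω| ≤ c) : Integrable (fun ω => Y ω * W ω) P :=
  (Integrable.of_bound hW.aestronglyMeasurable c (Eventually.of_forall hc)).bdd_mul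
    hY.aestronglyMeasurable (Eventually.of_forall hb)

lemma abs_ite_one_zero_le (q : Prop) [Decidable q] : |if q then (1 : ℝ) else 0| ≤ 1 := by
  split_ifs <;> simp

lemma abs_ite_zero_one_le (q : Prop) [Decidable q] : |if q then (0 : ℝ) else 1| ≤ 1 := by
  split_ifs <;> simp

/-- One time step of length `x`: the chain moves by `exp (x Q)`, and is then killed with probability
`x` times its rate, up to `O(x²)`. -/
lemma exists_step_bound (h : IsMMHPDelta P Q μ φ δ S N) (p k : ℕ) {K : ℝ} (hK : 0 ≤ K) :
    ∃ C, 0 ≤ C ∧ ∀ s x : ℝ≥0, k * δ ≤ s → (s : ℝ) + x ≤ (k + 1) * δ → (x : ℝ) ≤ 1 →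
      ∀ Y : Ω → ℝ, Measurable[jointAt h p s] Y → ∀ b, (∀ ω, |Y ω| ≤ b) →
      (∀ ω, ω ∉ aliveBdd μ φ δ N p k K s → Y ω = 0) → ∀ i,
      |∫ ω, Y ω * (if N (arrival N p ω + s + x) ω = p ∧ S (arrival N p ω + s + x) ω = i
          then 1 else 0) ∂P
        - ∫ ω, Y ω * ((1 - x * stepRate μ φ δ N p k i ω) *
            NormedSpace.exp ((x : ℝ) • Q) (S (arrival N p ω + s) ω) i) ∂P|
        ≤ b * C * x ^ 2 := by
  obtain ⟨C, hC, hkill⟩ := exists_kill_bound h p k hK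
  refine ⟨C, hC, fun s x hs hx hx1 Y hY b hb hY0 i => ?_⟩
  have hb0 : 0 ≤ b := by
    obtain ⟨ω⟩ : Nonempty Ω := P.nonempty_of_neZero
    exact (abs_nonneg _).trans (hb ω)
  have hYm : Measurable Y := hY.mono (jointAt_le h p s) le_rfl
  set I : Ω → ℝ := fun ω => if S (arrival N p ω + s + x) ω = i then 1 else 0 with hI
  have hIm : Measurable[fullAt h p s] I := measurable_state_ind h p s x i
  have hIm' : Measurable I := hIm.mono (fullAt_le h p s) le_rfl
  set U : Ω → ℝ := fun ω => if N (arrival N p ω + s + x) ω = p then 0 else 1 with hU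
  have hUm : Measurable U := measurable_event h p s x
  have hZb : ∀ ω, |Y ω * I ω| ≤ b := fun ω => by
    rw [abs_mul]
    calc _ ≤ b * 1 := mul_le_mul (hb ω) (abs_ite_one_zero_le _) (abs_nonneg _) hb0
      _ = b := mul_one b
  have hk := hkill s x hs hx hx1 (fun ω => Y ω * I ω)
    ((hY.mono (jointAt_le_fullAt h p s) le_rfl).mul hIm) b hZb
    (fun ω hω => by rw [hY0 ω hω, zero_mul])
  set r : Ω → ℝ := stepRate μ φ δ N p k i with hr
  have hrm : Measurable[jointAt h p s] r :=
    (measurable_stepRate h p k i s).mono (histAt_le_jointAt h p s) le_rfl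
  -- the strong Markov property for the weight `Y (1 - x r)`
  have hYr : Measurable[jointAt h p s] fun ω => Y ω * (1 - x * r ω) :=
    hY.mul (measurable_const.sub (hrm.const_mul _))
  have hYrb : ∀ ω, |Y ω * (1 - x * r ω)| ≤ b * (1 + K) := by
    intro ω
    by_cases hω : ω ∈ aliveBdd μ φ δ N p k K s
    · rw [abs_mul]
      refine mul_le_mul (hb ω) ?_ (abs_nonneg _) hb0
      have h1 := hω.2 i
      have h2 : |(x : ℝ) * r ω| ≤ 1 * K := by
        rw [abs_mul, abs_of_nonneg (NNReal.coe_nonneg x)]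
        exact mul_le_mul hx1 h1 (abs_nonneg _) zero_le_one
      have h3 := abs_sub (1 : ℝ) (x * r ω)
      rw [abs_one] at h3
      linarith
    · rw [hY0 ω hω, zero_mul, abs_zero]
      positivity
  have hsm := integral_mul_strong_markov h p s x i hYr hYrb fun ω hω => by
    rw [hY0 ω fun h1 => hω ⟨_, h1.1.ge⟩, zero_mul]
  have e1 : ∫ ω, Y ω * ((1 - x * r ω) *
      NormedSpace.exp ((x : ℝ) • Q) (S (arrival N p ω + s) ω) i) ∂P
      = ∫ ω, Y ω * (1 - x * r ω) * I ω ∂P := by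
    simp only [← mul_assoc]
    exact hsm.symm
  have e2 : ∫ ω, Y ω * (if N (arrival N p ω + s + x) ω = p ∧ S (arrival N p ω + s + x) ω = i
      then 1 else 0) ∂P = ∫ ω, (Y ω * I ω - Y ω * I ω * U ω) ∂P := by
    refine integral_congr_ae (Eventually.of_forall fun ω => ?_)
    simp only [hI, hU]
    by_cases h1 : N (arrival N p ω + s + x) ω = p <;>
      by_cases h2 : S (arrival N p ω + s + x) ω = i <;> simp [h1, h2]
  have e3 : ∫ ω, Y ω * (1 - x * r ω) * I ω ∂P
      = ∫ ω, (Y ω * I ω - Y ω * I ω *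
          (x * stepRate μ φ δ N p k (S (arrival N p ω + s + x) ω) ω)) ∂P := by
    refine integral_congr_ae (Eventually.of_forall fun ω => ?_)
    simp only [hI, hr]
    by_cases h2 : S (arrival N p ω + s + x) ω = i
    · simp only [h2, if_true]
      ring
    · simp [h2]
  have i1 : Integrable (fun ω => Y ω * I ω) P :=
    integrable_mul_of_bound hYm hIm' hb fun ω => abs_ite_one_zero_le _
  have i2 : Integrable (fun ω => Y ω * I ω * U ω) P :=
    integrable_mul_of_bound (hYm.mul hIm') hUm hZb fun ω => abs_ite_zero_one_le _
  have i3 : Integrable (fun ω => Y ω * I ω *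
      (x * stepRate μ φ δ N p k (S (arrival N p ω + s + x) ω) ω)) P := by
    have h3 : Integrable (fun ω => Y ω * (1 - x * r ω) * I ω) P :=
      integrable_mul_of_bound (hYr.mono (jointAt_le h p s) le_rfl) hIm' hYrb
        fun ω => abs_ite_one_zero_le _
    refine (i1.sub h3).congr (Eventually.of_forall fun ω => ?_)
    simp only [hI, hr, Pi.sub_apply]
    by_cases h2 : S (arrival N p ω + s + x) ω = i
    · simp only [h2, if_true]
      ring
    · simp [h2]
  rw [e1, e2, e3, integral_sub i1 i2, integral_sub i1 i3, sub_sub_sub_cancel_left, abs_sub_comm]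
  exact hk

/-- `Φ` gives the probabilities, conditionally on the joint history at `t_p + s`, that the next event
is after `t_p + s'` and that the chain is then in a given state; the statement is tested against
bounded weights which vanish unless there is no event in `(t_p, t_p + s]` and `𝒦` occurs. -/
structure IsTransition (h : IsMMHPDelta P Q μ φ δ S N) (p : ℕ) (𝒦 : Set Ω) (s s' : ℝ≥0)
    (Φ : Ω → Matrix (Fin M) (Fin M) ℝ) : Prop where
  le : s ≤ s'
  meas : ∀ i j, Measurable[histAt h p 0] fun ω => Φ ω i j
  bdd : ∃ C, 0 ≤ C ∧ ∀ ω ∈ 𝒦, ∀ i j, |Φ ω i j| ≤ C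
  integral_eq : ∀ X : Ω → ℝ, Measurable[jointAt h p s] X → ∀ b, (∀ ω, |X ω| ≤ b) →
    (∀ ω, ¬ (N (arrival N p ω + s) ω = p ∧ ω ∈ 𝒦) → X ω = 0) → ∀ j,
    ∫ ω, X ω * (if N (arrival N p ω + s') ω = p ∧ S (arrival N p ω + s') ω = j
      then 1 else 0) ∂P = ∫ ω, X ω * Φ ω (S (arrival N p ω + s) ω) j ∂P

/-- The event that the rates of the `δ`-steps up to the `L`-th are at most `K`. -/
def rateBdd (μ : Fin M → ℝ) (φ : Fin M → ℝ → ℝ) (δ : ℝ) (N : ℝ≥0 → Ω → ℕ) (p L : ℕ) (K : ℝ) :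
    Set Ω := {ω | ∀ k ≤ L, ∀ i, |stepRate μ φ δ N p k i ω| ≤ K}

/-- Within one `δ`-step, the transition probabilities are the entries of the exponential of `Q - Λ`
times the elapsed time. With `g s` the expectation of the weight times the probability predicted from
`t_p + s` to the end of the interval, the increments of `g` are `O(x²)`, so that `g` is constant. -/
lemma isTransition_stepExp (h : IsMMHPDelta P Q μ φ δ S N) (p : ℕ) {L k : ℕ} (hk : k ≤ L) {K : ℝ}
    (hK : 0 ≤ K) {a c : ℝ≥0} (hac : a ≤ c) (ha : k * δ ≤ a) (hc : (c : ℝ) ≤ (k + 1) * δ) :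
    IsTransition h p (rateBdd μ φ δ N p L K) a c (stepExp Q μ φ δ N p k (c - a)) := by
  obtain ⟨C₁, hC₁, hexp⟩ := exists_exp_bound Q (H := c - a) hK
  obtain ⟨C₂, hC₂, hsplit⟩ := exists_splitting_bound Q hK
  obtain ⟨C₃, hC₃, hstep⟩ := exists_step_bound h p k hK
  have hac' : (0 : ℝ) ≤ c - a := sub_nonneg.2 (NNReal.coe_le_coe.2 hac)
  refine ⟨hac, measurable_stepExp h p k _, ⟨C₁, hC₁, fun ω hω i j =>
    hexp _ (fun i => hω k hk i) _ hac' le_rfl i j⟩, fun X hX b hb hX0 j => ?_⟩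
  have hb0 : 0 ≤ b := by
    obtain ⟨ω⟩ : Nonempty Ω := P.nonempty_of_neZero
    exact (abs_nonneg _).trans (hb ω)
  -- the weight, set to zero once an event has occurred
  set W : ℝ≥0 → Ω → ℝ := fun s ω => X ω * (if N (arrival N p ω + s) ω = p then 1 else 0) with hW
  have hWm : ∀ s, a ≤ s → Measurable[jointAt h p s] (W s) := fun s hs =>
    (hX.mono (jointAt_mono h p hs) le_rfl).mul
      ((measurable_of_countable fun k : ℕ => if k = p then (1 : ℝ) else 0).comp
        ((measurable_counting_at h p s).mono (histAt_le_jointAt h p s) le_rfl))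
  have hWb : ∀ s ω, |W s ω| ≤ b := fun s ω => by
    rw [hW, abs_mul]
    calc _ ≤ b * 1 := mul_le_mul (hb ω) (abs_ite_one_zero_le _) (abs_nonneg _) hb0
      _ = b := mul_one b
  have hW0 : ∀ s ω, ω ∉ aliveBdd μ φ δ N p k K s → W s ω = 0 := by
    intro s ω hω
    by_cases h1 : N (arrival N p ω + s) ω = p
    · have h2 : X ω = 0 := hX0 ω fun h3 => hω ⟨h1, fun i => h3.2 k hk i⟩
      simp [hW, h2]
    · simp [hW, h1]
  set g : ℝ≥0 → ℝ := fun s =>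
    ∫ ω, W s ω * stepExp Q μ φ δ N p k (c - s) ω (S (arrival N p ω + s) ω) j ∂P with hg
  have hinc : ∀ s x : ℝ≥0, a ≤ s → s + x ≤ c → (x : ℝ) ≤ 1 →
      |g (s + x) - g s| ≤ (M * (b * C₁ * C₃) + b * (M * (C₂ * C₁))) * x ^ 2 := by
    intro s x hs hsx hx1
    have hsx' : (s : ℝ) + x ≤ c := by exact_mod_cast hsx
    have hs' : (a : ℝ) ≤ s := by exact_mod_cast hs
    have hx0 : (0 : ℝ) ≤ x := x.2
    set E : Ω → Matrix (Fin M) (Fin M) ℝ := stepExp Q μ φ δ N p k (c - (s + x)) with hE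
    have hEb : ∀ s', ∀ ω ∈ aliveBdd μ φ δ N p k K s', ∀ i, |E ω i j| ≤ C₁ := fun s' ω hω i =>
      hexp _ hω.2 _ (by linarith) (by linarith) i j
    set Y : Fin M → Ω → ℝ := fun i ω => W s ω * E ω i j with hY
    have hYm : ∀ i, Measurable[jointAt h p s] (Y i) := fun i =>
      (hWm s hs).mul ((measurable_stepExp h p k _ i j).mono
        ((histAt_mono h p (zero_le : 0 ≤ s)).trans (histAt_le_jointAt h p s)) le_rfl)
    have hYb : ∀ i ω, |Y i ω| ≤ b * C₁ := by
      intro i ω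
      by_cases hω : ω ∈ aliveBdd μ φ δ N p k K s
      · rw [hY, abs_mul]
        exact mul_le_mul (hWb s ω) (hEb s ω hω i) (abs_nonneg _) hb0
      · simp only [hY, hW0 s ω hω, zero_mul, abs_zero]
        positivity
    have hY0 : ∀ i ω, ω ∉ aliveBdd μ φ δ N p k K s → Y i ω = 0 := fun i ω hω => by
      simp only [hY, hW0 s ω hω, zero_mul]
    have hYm' : ∀ i, Measurable (Y i) := fun i => (hYm i).mono (jointAt_le h p s) le_rfl
    have hind : ∀ i, Measurable fun ω => if N (arrival N p ω + s + x) ω = p ∧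
        S (arrival N p ω + s + x) ω = i then (1 : ℝ) else 0 := fun i => by
      have ht : Measurable fun ω => arrival N p ω + s + x :=
        ((measurable_arrival h p).add_const s).add_const x
      exact Measurable.ite ((measurable_counting_comp h ht (measurableSet_singleton p)).inter
        (measurable_chain_comp h ht (measurableSet_singleton i))) measurable_const measurable_const
    have hmv : ∀ i, Measurable fun ω => (1 - x * stepRate μ φ δ N p k i ω) *
        NormedSpace.exp ((x : ℝ) • Q) (S (arrival N p ω + s) ω) i := fun i =>
      (measurable_const.sub (((measurable_stepRate h p k i 0).mono (histAt_le h p 0)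
        le_rfl).const_mul _)).mul ((measurable_of_countable fun l : Fin M =>
          NormedSpace.exp ((x : ℝ) • Q) l i).comp
            (measurable_chain_comp h ((measurable_arrival h p).add_const s)))
    -- the prediction from `t_p + s + x`, decomposed by the state at that time
    have e1 : g (s + x) = ∑ i, ∫ ω, Y i ω * (if N (arrival N p ω + s + x) ω = p ∧
        S (arrival N p ω + s + x) ω = i then 1 else 0) ∂P := by
      rw [← integral_finsetSum _ fun i _ => integrable_mul_of_bound (hYm' i) (hind i) (hYb i)
        fun ω => abs_ite_one_zero_le _]
      refine integral_congr_ae (Eventually.of_forall fun ω => ?_)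
      simp only [hY, hW, NNReal.coe_add, ← add_assoc]
      by_cases h1 : N (arrival N p ω + s + x) ω = p
      · by_cases hXω : X ω = 0
        · simp [hXω]
        · have h2 : N (arrival N p ω + a) ω = p ∧ ω ∈ rateBdd μ φ δ N p L K := by
            by_contra h3
            exact hXω (hX0 ω h3)
          have h3 : N (arrival N p ω + s) ω = p := by
            refine le_antisymm ((h.counting.mono ω le_self_add).trans h1.le)
              (h2.1.ge.trans (h.counting.mono ω (by gcongr)))
          simp [h1, h3, hE]
      · simp [h1]
    have hmain : |g (s + x) - ∑ i, ∫ ω, Y i ω * ((1 - x * stepRate μ φ δ N p k i ω) *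
        NormedSpace.exp ((x : ℝ) • Q) (S (arrival N p ω + s) ω) i) ∂P|
        ≤ M * (b * C₁ * C₃) * x ^ 2 := by
      rw [e1, ← Finset.sum_sub_distrib]
      refine (Finset.abs_sum_le_sum_abs _ _).trans ?_
      calc _ ≤ ∑ _i : Fin M, b * C₁ * C₃ * (x : ℝ) ^ 2 :=
            Finset.sum_le_sum fun i _ => hstep s x (ha.trans hs') (hsx'.trans hc) hx1 (Y i) (hYm i)
              (b * C₁) (hYb i) (hY0 i) i
        _ = _ := by
            rw [Finset.sum_const, Finset.card_univ, Fintype.card_fin, nsmul_eq_mul]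
            ring
    have hint : ∀ i, Integrable (fun ω => Y i ω * ((1 - x * stepRate μ φ δ N p k i ω) *
        NormedSpace.exp ((x : ℝ) • Q) (S (arrival N p ω + s) ω) i)) P := by
      intro i
      have hm := (hYm' i).mul (hmv i)
      obtain ⟨D, hD⟩ : ∃ D, ∀ l, |NormedSpace.exp ((x : ℝ) • Q) l i| ≤ D :=
        ⟨∑ l, |NormedSpace.exp ((x : ℝ) • Q) l i|, fun l =>
          Finset.single_le_sum (f := fun l => |NormedSpace.exp ((x : ℝ) • Q) l i|)
            (fun _ _ => abs_nonneg _) (Finset.mem_univ l)⟩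
      refine Integrable.of_bound hm.aestronglyMeasurable (b * C₁ * ((1 + K) * D))
        (Eventually.of_forall fun ω => ?_)
      have hD0 : 0 ≤ D := (abs_nonneg _).trans (hD i)
      by_cases hω : ω ∈ aliveBdd μ φ δ N p k K s
      · rw [Real.norm_eq_abs, abs_mul (Y i ω), abs_mul (1 - x * stepRate μ φ δ N p k i ω)]
        have h1 : |1 - x * stepRate μ φ δ N p k i ω| ≤ 1 + K := by
          have h2 : |(x : ℝ) * stepRate μ φ δ N p k i ω| ≤ 1 * K := by
            rw [abs_mul, abs_of_nonneg hx0]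
            exact mul_le_mul hx1 (hω.2 i) (abs_nonneg _) zero_le_one
          have h3 := abs_sub (1 : ℝ) (x * stepRate μ φ δ N p k i ω)
          rw [abs_one] at h3
          linarith
        have h4 := hYb i ω
        have h5 := hD (S (arrival N p ω + s) ω)
        exact mul_le_mul h4 (mul_le_mul h1 h5 (abs_nonneg _) (by positivity)) (by positivity)
          (by positivity)
      · rw [hY0 i ω hω, zero_mul, norm_zero]
        positivity
    have hgint : Integrable (fun ω => W s ω *
        stepExp Q μ φ δ N p k (c - s) ω (S (arrival N p ω + s) ω) j) P := by
      have hm := ((hWm s hs).mul (measurable_apply_chain h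
        (measurable_stepExp h p k (c - s)) s j)).mono (jointAt_le h p s) le_rfl
      refine Integrable.of_bound hm.aestronglyMeasurable (b * C₁) (Eventually.of_forall fun ω => ?_)
      by_cases hω : ω ∈ aliveBdd μ φ δ N p k K s
      · rw [Real.norm_eq_abs, abs_mul]
        exact mul_le_mul (hWb s ω) (hexp _ hω.2 _ (by linarith) (by linarith) _ j)
          (abs_nonneg _) hb0
      · rw [hW0 s ω hω, zero_mul, norm_zero]
        positivity
    -- both predictions are from the state at `t_p + s`, by matrices which differ by `O(x²)`
    have hmat : |∑ i, ∫ ω, Y i ω * ((1 - x * stepRate μ φ δ N p k i ω) *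
        NormedSpace.exp ((x : ℝ) • Q) (S (arrival N p ω + s) ω) i) ∂P - g s|
        ≤ b * (M * (C₂ * C₁)) * x ^ 2 := by
      rw [← integral_finsetSum _ fun i _ => hint i, hg,
        ← integral_sub (integrable_finsetSum _ fun i _ => hint i) hgint, ← Real.norm_eq_abs]
      refine (norm_integral_le_of_norm_le (integrable_const (b * (M * (C₂ * C₁)) * x ^ 2))
        (Eventually.of_forall fun ω => ?_)).trans (le_of_eq (by simp))
      by_cases hω : ω ∈ aliveBdd μ φ δ N p k K s
      swap
      · simp only [hY0 _ ω hω, hW0 s ω hω, zero_mul, Finset.sum_const_zero, sub_zero, norm_zero]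
        positivity
      set l := S (arrival N p ω + s) ω with hl
      set d : Fin M → ℝ := fun i => stepRate μ φ δ N p k i ω with hd
      have hsum : stepExp Q μ φ δ N p k (c - s) ω
          = NormedSpace.exp ((x : ℝ) • (Q - Matrix.diagonal d)) * E ω := by
        rw [hE, stepExp, stepExp, stepLambda_eq_diagonal, ← exp_add_smul]
        congr 2
        ring
      have hentry : ∑ i, Y i ω * ((1 - x * stepRate μ φ δ N p k i ω) *
            NormedSpace.exp ((x : ℝ) • Q) l i)
            - W s ω * stepExp Q μ φ δ N p k (c - s) ω l j
          = W s ω * ∑ i, (NormedSpace.exp ((x : ℝ) • Q) * (1 - (x : ℝ) • Matrix.diagonal d)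
            - NormedSpace.exp ((x : ℝ) • (Q - Matrix.diagonal d))) l i * E ω i j := by
        have h1 : (1 - (x : ℝ) • Matrix.diagonal d : Matrix (Fin M) (Fin M) ℝ)
            = Matrix.diagonal fun i => 1 - x * d i := by
          rw [← Matrix.diagonal_one, ← Matrix.diagonal_smul, Matrix.diagonal_sub]
          rfl
        rw [hsum, Matrix.mul_apply, Finset.mul_sum, Finset.mul_sum, ← Finset.sum_sub_distrib]
        refine Finset.sum_congr rfl fun i _ => ?_
        rw [Matrix.sub_apply, h1, Matrix.mul_diagonal]
        simp only [hY, hd]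
        ring
      rw [hentry, norm_mul, Real.norm_eq_abs, Real.norm_eq_abs, mul_assoc b]
      refine mul_le_mul (hWb s ω) ?_ (abs_nonneg _) hb0
      refine (Finset.abs_sum_le_sum_abs _ _).trans ?_
      calc _ ≤ ∑ _i : Fin M, C₂ * (x : ℝ) ^ 2 * C₁ := by
            refine Finset.sum_le_sum fun i _ => ?_
            rw [abs_mul]
            exact mul_le_mul (hsplit d hω.2 x hx0 hx1 l i) (hEb s ω hω i) (abs_nonneg _)
              (by positivity)
        _ = _ := by
            rw [Finset.sum_const, Finset.card_univ, Fintype.card_fin, nsmul_eq_mul]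
            ring
    calc _ ≤ _ := abs_sub_le _ _ _
      _ ≤ _ := add_le_add hmain hmat
      _ = _ := by ring
  have hconst := eq_of_abs_sub_le_sq hac hinc
  calc _ = g c := by
        refine integral_congr_ae (Eventually.of_forall fun ω => ?_)
        simp only [hW, stepExp, sub_self, zero_smul, NormedSpace.exp_zero, Matrix.one_apply]
        by_cases h1 : N (arrival N p ω + c) ω = p <;> simp [h1]
    _ = g a := hconst
    _ = _ := by
        refine integral_congr_ae (Eventually.of_forall fun ω => ?_)
        simp only [hW]
        by_cases h1 : N (arrival N p ω + a) ω = p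
        · simp [h1]
        · simp [h1, hX0 ω fun h2 => h1 h2.1]

end Step

/-! ### Composition of transitions -/

section Composition

open Filter Topology

variable {Ω : Type*} [mΩ : MeasurableSpace Ω] {M : ℕ} {P : Measure Ω}
  {Q : Matrix (Fin M) (Fin M) ℝ} {μ : Fin M → ℝ}
  {φ : Fin M → ℝ → ℝ} {δ : ℝ} {S : ℝ≥0 → Ω → Fin M} {N : ℝ≥0 → Ω → ℕ}

lemma isTransition_one (h : IsMMHPDelta P Q μ φ δ S N) (p : ℕ) (𝒦 : Set Ω) (s : ℝ≥0) :
    IsTransition h p 𝒦 s s fun _ => 1 := by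
  refine ⟨le_rfl, fun i j => measurable_const, ⟨1, zero_le_one, fun ω _ i j => ?_⟩,
    fun X _ b _ hX0 j => ?_⟩
  · rw [Matrix.one_apply]
    exact abs_ite_one_zero_le _
  · refine integral_congr_ae (Eventually.of_forall fun ω => ?_)
    by_cases h1 : N (arrival N p ω + s) ω = p
    · simp [h1, Matrix.one_apply]
    · simp [hX0 ω fun h2 => h1 h2.1]

variable [IsProbabilityMeasure P]

/-- The Chapman–Kolmogorov equation for the killed chain. -/
lemma IsTransition.trans {h : IsMMHPDelta P Q μ φ δ S N} {p : ℕ} {𝒦 : Set Ω} {s s' s'' : ℝ≥0}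
    {Φ Φ' : Ω → Matrix (Fin M) (Fin M) ℝ} (hΦ : IsTransition h p 𝒦 s s' Φ)
    (hΦ' : IsTransition h p 𝒦 s' s'' Φ') :
    IsTransition h p 𝒦 s s'' fun ω => Φ ω * Φ' ω := by
  obtain ⟨C, hC, hbd⟩ := hΦ.bdd
  obtain ⟨C', hC', hbd'⟩ := hΦ'.bdd
  refine ⟨hΦ.le.trans hΦ'.le, fun i j => ?_, ⟨M * (C * C'), by positivity, fun ω hω i j => ?_⟩,
    fun X hX b hb hX0 j => ?_⟩
  · simp only [Matrix.mul_apply]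
    exact Finset.measurable_sum _ fun l _ => (hΦ.meas i l).mul (hΦ'.meas l j)
  · rw [Matrix.mul_apply]
    refine (Finset.abs_sum_le_sum_abs _ _).trans ?_
    calc _ ≤ ∑ _l : Fin M, C * C' := by
          refine Finset.sum_le_sum fun l _ => ?_
          rw [abs_mul]
          exact mul_le_mul (hbd ω hω i l) (hbd' ω hω l j) (abs_nonneg _) hC
      _ = _ := by rw [Finset.sum_const, Finset.card_univ, Fintype.card_fin, nsmul_eq_mul]
  have hb0 : 0 ≤ b := by
    obtain ⟨ω⟩ : Nonempty Ω := P.nonempty_of_neZero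
    exact (abs_nonneg _).trans (hb ω)
  have hXm : Measurable X := hX.mono (jointAt_le h p s) le_rfl
  have hle0 : histAt h p 0 ≤ jointAt h p s :=
    (histAt_mono h p (zero_le : 0 ≤ s)).trans (histAt_le_jointAt h p s)
  set X' : Ω → ℝ := fun ω => X ω * (if N (arrival N p ω + s') ω = p then 1 else 0) with hX'
  have hX'm : Measurable[jointAt h p s'] X' :=
    (hX.mono (jointAt_mono h p hΦ.le) le_rfl).mul
      ((measurable_of_countable fun k : ℕ => if k = p then (1 : ℝ) else 0).comp
        ((measurable_counting_at h p s').mono (histAt_le_jointAt h p s') le_rfl))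
  have hX'b : ∀ ω, |X' ω| ≤ b := fun ω => by
    rw [hX', abs_mul]
    calc _ ≤ b * 1 := mul_le_mul (hb ω) (abs_ite_one_zero_le _) (abs_nonneg _) hb0
      _ = b := mul_one b
  have hX'0 : ∀ ω, ¬ (N (arrival N p ω + s') ω = p ∧ ω ∈ 𝒦) → X' ω = 0 := by
    intro ω hω
    by_cases h1 : N (arrival N p ω + s') ω = p
    · simp [hX', hX0 ω fun h2 => hω ⟨h1, h2.2⟩]
    · simp [hX', h1]
  -- the weights which select the state at the intermediate time
  set Y : Fin M → Ω → ℝ := fun i ω => X ω * Φ' ω i j with hY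
  have hYm : ∀ i, Measurable[jointAt h p s] (Y i) := fun i =>
    hX.mul ((hΦ'.meas i j).mono hle0 le_rfl)
  have hYb : ∀ i ω, |Y i ω| ≤ b * C' := by
    intro i ω
    by_cases hω : ω ∈ 𝒦
    · rw [hY, abs_mul]
      exact mul_le_mul (hb ω) (hbd' ω hω i j) (abs_nonneg _) hb0
    · simp only [hY, hX0 ω fun h1 => hω h1.2, zero_mul, abs_zero]
      positivity
  have hY0 : ∀ i ω, ¬ (N (arrival N p ω + s) ω = p ∧ ω ∈ 𝒦) → Y i ω = 0 := fun i ω hω => by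
    simp only [hY, hX0 ω hω, zero_mul]
  have hind : ∀ i, Measurable fun ω => if N (arrival N p ω + s') ω = p ∧
      S (arrival N p ω + s') ω = i then (1 : ℝ) else 0 := fun i => by
    have ht : Measurable fun ω => arrival N p ω + s' := (measurable_arrival h p).add_const s'
    exact Measurable.ite ((measurable_counting_comp h ht (measurableSet_singleton p)).inter
      (measurable_chain_comp h ht (measurableSet_singleton i))) measurable_const measurable_const
  calc _ = ∫ ω, X' ω * (if N (arrival N p ω + s'') ω = p ∧ S (arrival N p ω + s'') ω = j
        then 1 else 0) ∂P := by
        refine integral_congr_ae (Eventually.of_forall fun ω => ?_)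
        simp only [hX']
        by_cases h1 : N (arrival N p ω + s'') ω = p
        · by_cases hXω : X ω = 0
          · simp [hXω]
          · have h2 : N (arrival N p ω + s) ω = p := by
              by_contra h3
              exact hXω (hX0 ω fun h4 => h3 h4.1)
            have h3 : N (arrival N p ω + s') ω = p := by
              have l1 := hΦ.le
              have l2 := hΦ'.le
              exact le_antisymm ((h.counting.mono ω (by gcongr)).trans h1.le)
                (h2.ge.trans (h.counting.mono ω (by gcongr)))
            simp [h3]
        · simp [h1]
    _ = ∫ ω, X' ω * Φ' ω (S (arrival N p ω + s') ω) j ∂P :=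
        hΦ'.integral_eq X' hX'm b hX'b hX'0 j
    _ = ∫ ω, ∑ i, Y i ω * (if N (arrival N p ω + s') ω = p ∧ S (arrival N p ω + s') ω = i
          then 1 else 0) ∂P := by
        refine integral_congr_ae (Eventually.of_forall fun ω => ?_)
        simp only [hX', hY]
        by_cases h1 : N (arrival N p ω + s') ω = p <;> simp [h1]
    _ = ∑ i, ∫ ω, Y i ω * (if N (arrival N p ω + s') ω = p ∧ S (arrival N p ω + s') ω = i
          then 1 else 0) ∂P :=
        integral_finsetSum _ fun i _ => integrable_mul_of_bound
          ((hYm i).mono (jointAt_le h p s) le_rfl) (hind i) (hYb i) fun ω => abs_ite_one_zero_le _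
    _ = ∑ i, ∫ ω, Y i ω * Φ ω (S (arrival N p ω + s) ω) i ∂P :=
        Finset.sum_congr rfl fun i _ => hΦ.integral_eq (Y i) (hYm i) _ (hYb i) (hY0 i) i
    _ = ∫ ω, ∑ i, Y i ω * Φ ω (S (arrival N p ω + s) ω) i ∂P := by
        refine (integral_finsetSum _ fun i _ => ?_).symm
        have hm := ((hYm i).mul (measurable_apply_chain h hΦ.meas s i)).mono (jointAt_le h p s) le_rfl
        refine Integrable.of_bound hm.aestronglyMeasurable (b * C' * C)
          (Eventually.of_forall fun ω => ?_)
        by_cases hω : ω ∈ 𝒦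
        · rw [norm_mul]
          exact mul_le_mul (hYb i ω) (hbd ω hω _ _) (abs_nonneg _) (by positivity)
        · rw [hY0 i ω fun h1 => hω h1.2, zero_mul, norm_zero]
          positivity
    _ = _ := by
        refine integral_congr_ae (Eventually.of_forall fun ω => ?_)
        simp only [hY, Matrix.mul_apply, Finset.mul_sum]
        exact Finset.sum_congr rfl fun i _ => by ring

end Composition

/-! ### The closed forms -/

section Formulas

variable {Ω : Type*} [mΩ : MeasurableSpace Ω] {M : ℕ}

lemma Xi_succ (Q : Matrix (Fin M) (Fin M) ℝ) (L : ℕ → Matrix (Fin M) (Fin M) ℝ) (δ : ℝ) (k : ℕ) :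
    Xi Q L δ (k + 1) = Xi Q L δ k * NormedSpace.exp (δ • (Q - L k)) := by
  rw [Xi, Xi, List.range'_concat, List.map_append, List.prod_append]
  simp

lemma Psi_succ (Q : Matrix (Fin M) (Fin M) ℝ) (L : ℕ → Matrix (Fin M) (Fin M) ℝ) (δ : ℝ)
    (l k : ℕ) :
    Psi Q L δ l (k + 1) = NormedSpace.exp (δ • (Q - L (l - (k + 1)))) * Psi Q L δ l k := by
  rw [Psi, Psi, List.range'_succ, List.map_cons, List.prod_cons, ← List.map_add_range',
    List.map_map]
  congr 3
  funext r
  simp only [Function.comp_apply]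
  congr 5
  omega

variable {P : Measure Ω} [IsProbabilityMeasure P]
  {Q : Matrix (Fin M) (Fin M) ℝ} {μ : Fin M → ℝ}
  {φ : Fin M → ℝ → ℝ} {δ : ℝ} {S : ℝ≥0 → Ω → Fin M} {N : ℝ≥0 → Ω → ℕ}

/-- `isTransition_stepExp` with the elapsed time as a separate real variable. -/
lemma isTransition_exp (h : IsMMHPDelta P Q μ φ δ S N) (p : ℕ) {L k : ℕ} (hk : k ≤ L) {K : ℝ}
    (hK : 0 ≤ K) {a c : ℝ≥0} {t : ℝ} (ht : (a : ℝ) + t = c) (ht0 : 0 ≤ t) (ha : k * δ ≤ a)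
    (hc : (c : ℝ) ≤ (k + 1) * δ) :
    IsTransition h p (rateBdd μ φ δ N p L K) a c
      fun ω => NormedSpace.exp (t • (Q - stepLambda μ φ δ N (p + 1) k ω)) := by
  have hac : a ≤ c := NNReal.coe_le_coe.1 (by linarith)
  have h1 := isTransition_stepExp h p hk hK hac ha hc
  rwa [← ht, add_sub_cancel_left] at h1

/-- The time `k δ`. -/
noncomputable def stepTime (δ : ℝ) (k : ℕ) : ℝ≥0 := k * δ.toNNReal

lemma coe_stepTime {δ : ℝ} (hδ : 0 ≤ δ) (k : ℕ) : (stepTime δ k : ℝ) = k * δ := by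
  rw [stepTime, NNReal.coe_mul, Real.coe_toNNReal _ hδ, NNReal.coe_natCast]

lemma isTransition_Xi (h : IsMMHPDelta P Q μ φ δ S N) (p : ℕ) {L : ℕ} {K : ℝ} (hK : 0 ≤ K) :
    ∀ k ≤ L, IsTransition h p (rateBdd μ φ δ N p L K) 0 (stepTime δ k)
      fun ω => Xi Q (fun k => stepLambda μ φ δ N (p + 1) k ω) δ k := by
  have hδ := h.step_pos
  intro k
  induction k with
  | zero =>
    intro _
    have h0 : stepTime δ 0 = 0 := by simp [stepTime]
    rw [h0]
    simpa [Xi] using isTransition_one h p (rateBdd μ φ δ N p L K) 0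
  | succ k ih =>
    intro hk
    simp only [Xi_succ]
    refine (ih (by omega)).trans (isTransition_exp h p (by omega) hK ?_ hδ.le ?_ ?_)
    · rw [coe_stepTime hδ.le, coe_stepTime hδ.le]
      push_cast
      ring
    · rw [coe_stepTime hδ.le]
    · rw [coe_stepTime hδ.le]
      push_cast
      exact le_rfl

lemma isTransition_Psi (h : IsMMHPDelta P Q μ φ δ S N) (p : ℕ) {L l : ℕ} (hl : l ≤ L) {K : ℝ}
    (hK : 0 ≤ K) :
    ∀ k ≤ l, IsTransition h p (rateBdd μ φ δ N p L K) (stepTime δ (l - k)) (stepTime δ l)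
      fun ω => Psi Q (fun k => stepLambda μ φ δ N (p + 1) k ω) δ l k := by
  have hδ := h.step_pos
  intro k
  induction k with
  | zero =>
    intro _
    simpa [Psi] using isTransition_one h p (rateBdd μ φ δ N p L K) (stepTime δ l)
  | succ k ih =>
    intro hk
    simp only [Psi_succ]
    have hlk : ((l - k : ℕ) : ℝ) = ((l - (k + 1) : ℕ) : ℝ) + 1 := by
      rw [Nat.cast_sub (by omega), Nat.cast_sub hk]
      push_cast
      ring
    refine (isTransition_exp h p (by omega) hK ?_ hδ.le ?_ ?_).trans (ih (by omega))
    · rw [coe_stepTime hδ.le, coe_stepTime hδ.le, hlk]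
      ring
    · rw [coe_stepTime hδ.le]
    · rw [coe_stepTime hδ.le, hlk]

lemma isTransition_forwardFormula (h : IsMMHPDelta P Q μ φ δ S N) (p : ℕ) (u : ℝ≥0) {K : ℝ}
    (hK : 0 ≤ K) :
    IsTransition h p (rateBdd μ φ δ N p ⌊(u : ℝ) / δ⌋₊ K) 0 u
      fun ω => forwardFormula Q (fun k => stepLambda μ φ δ N (p + 1) k ω) δ u := by
  have hδ := h.step_pos
  have h1 : (⌊(u : ℝ) / δ⌋₊ : ℝ) * δ ≤ u := by
    rw [← le_div_iff₀ hδ]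
    exact Nat.floor_le (by positivity)
  have h2 : (u : ℝ) ≤ (⌊(u : ℝ) / δ⌋₊ + 1) * δ := by
    rw [← div_le_iff₀ hδ]
    exact (Nat.lt_floor_add_one _).le
  unfold forwardFormula
  refine (isTransition_Xi h p hK _ le_rfl).trans (isTransition_exp h p le_rfl hK ?_ ?_ ?_ h2)
  · rw [coe_stepTime hδ.le]
    ring
  · linarith
  · rw [coe_stepTime hδ.le]

lemma isTransition_backwardFormula (h : IsMMHPDelta P Q μ φ δ S N) (p : ℕ) {x u : ℝ≥0}
    (hx : 0 < x) (hu : u ≤ x) {K : ℝ} (hK : 0 ≤ K) :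
    IsTransition h p (rateBdd μ φ δ N p (fullSteps δ x) K) (x - u) x
      fun ω => backwardFormula Q (fun k => stepLambda μ φ δ N (p + 1) k ω) δ x u := by
  have hδ := h.step_pos
  have hx' : (0 : ℝ) < x := NNReal.coe_pos.2 hx
  have hu' : (u : ℝ) ≤ x := NNReal.coe_le_coe.2 hu
  have hxu : ((x - u : ℝ≥0) : ℝ) = x - u := NNReal.coe_sub hu
  set l := fullSteps δ x with hl
  have hceil : ((l : ℕ) : ℝ) + 1 = (⌈(x : ℝ) / δ⌉₊ : ℕ) := by
    have h1 : 0 < ⌈(x : ℝ) / δ⌉₊ := Nat.ceil_pos.2 (by positivity)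
    rw [hl, fullSteps, Nat.cast_sub (by omega)]
    push_cast
    ring
  have hxl : (x : ℝ) ≤ (l + 1) * δ := by
    rw [hceil, ← div_le_iff₀ hδ]
    exact Nat.le_ceil _
  have hlx : (l : ℝ) * δ ≤ x := by
    rw [← le_div_iff₀ hδ]
    have h1 := Nat.ceil_lt_add_one (a := (x : ℝ) / δ) (by positivity)
    rw [← hceil] at h1
    linarith
  have hres : residualTime δ x = x - l * δ := rfl
  unfold backwardFormula
  rw [← hl]
  split_ifs with hcase
  · rw [hres] at hcase
    refine isTransition_exp h p le_rfl hK ?_ u.2 ?_ hxl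
    · rw [hxu]
      exact sub_add_cancel _ _
    · rw [hxu]
      linarith
  · rw [hres, not_le] at hcase
    set m := ⌊((x : ℝ) - u) / δ⌋₊ with hm
    have h1 : (m : ℝ) * δ ≤ x - u := by
      rw [← le_div_iff₀ hδ]
      exact Nat.floor_le (div_nonneg (by linarith) hδ.le)
    have h2 : (x : ℝ) - u ≤ (m + 1) * δ := by
      rw [← div_le_iff₀ hδ]
      exact (Nat.lt_floor_add_one _).le
    have hml : m < l := by
      have h3 : (m : ℝ) * δ < l * δ := by linarith
      exact_mod_cast lt_of_mul_lt_mul_right h3 hδ.le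
    have hlm : l - (l - m - 1) = m + 1 := by omega
    have hPsi := isTransition_Psi h p (le_refl l) hK (l - m - 1) (by omega)
    rw [hlm] at hPsi
    refine IsTransition.trans (IsTransition.trans (isTransition_exp h p hml.le hK ?_ ?_ ?_ ?_) hPsi)
      (isTransition_exp h p le_rfl hK ?_ ?_ ?_ hxl)
    · rw [hres, hxu, coe_stepTime hδ.le]
      push_cast
      ring
    · rw [hres]
      linarith
    · rw [hxu]
      exact h1
    · rw [coe_stepTime hδ.le]
      push_cast
      exact le_rfl
    · rw [hres, coe_stepTime hδ.le]
      ring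
    · rw [hres]
      linarith
    · rw [coe_stepTime hδ.le]

end Formulas

/-! ### From weights to conditional probabilities -/

section ConditionalProbability

open Filter Topology

variable {Ω : Type*} [mΩ : MeasurableSpace Ω] {M : ℕ} {P : Measure Ω} [IsProbabilityMeasure P]
  {Q : Matrix (Fin M) (Fin M) ℝ} {μ : Fin M → ℝ}
  {φ : Fin M → ℝ → ℝ} {δ : ℝ} {S : ℝ≥0 → Ω → Fin M} {N : ℝ≥0 → Ω → ℕ}

/-- The σ-algebra generated by the state at `t_p + s` and the history of `N` stopped there. -/
noncomputable abbrev stateHistAt (h : IsMMHPDelta P Q μ φ δ S N) (p : ℕ) (s : ℝ≥0) :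
    MeasurableSpace Ω :=
  MeasurableSpace.comap (stoppedValue S (timeAfter N (p + 1) s)) inferInstance ⊔ histAt h p s

/-- A transition matrix in the sense of `IsTransition` is the conditional probability given the state
at `t_p + s` and the history of `N`. -/
lemma ae_noEventTransition_eq_of_mem (h : IsMMHPDelta P Q μ φ δ S N) (p : ℕ) {L : ℕ} {K : ℝ}
    {s w : ℝ≥0} {Φ : Ω → Matrix (Fin M) (Fin M) ℝ}
    (hΦ : IsTransition h p (rateBdd μ φ δ N p L K) s (s + w) Φ) (j : Fin M) :
    ∀ᵐ ω ∂P, N (arrival N p ω + s) ω = p → ω ∈ rateBdd μ φ δ N p L K →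
      noEventTransition P S N h.measurable_counting (stoppingTime_history h p s) w j ω
        = Φ ω (S (arrival N p ω + s) ω) j := by
  obtain ⟨C, hC, hbd⟩ := hΦ.bdd
  set σ := timeAfter N (p + 1) s with hσ
  have hmj : stateHistAt h p s ≤ jointAt h p s := by
    refine sup_le ?_ (histAt_le_jointAt h p s)
    exact (measurable_stoppedValue (isStronglyProgressive_chain h)
      (stoppingTime_joint h p s)).comap_le
  have hmΩ : stateHistAt h p s ≤ mΩ := hmj.trans (jointAt_le h p s)
  have hhist : histAt h p s ≤ stateHistAt h p s := le_sup_right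
  set E : Set Ω := {ω | N (arrival N p ω + s) ω = p ∧ ω ∈ rateBdd μ φ δ N p L K} with hE
  have hEm : MeasurableSet[stateHistAt h p s] E := by
    have h2 : E = (fun ω => N (arrival N p ω + s) ω) ⁻¹' {p} ∩
        ⋂ k ∈ Finset.range (L + 1), ⋂ i, {ω | |stepRate μ φ δ N p k i ω| ≤ K} := by
      ext ω
      simp [hE, rateBdd]
    rw [h2]
    refine hhist _ (MeasurableSet.inter
      (measurable_counting_at h p s (measurableSet_singleton p)) ?_)
    exact Finset.measurableSet_biInter _ fun k _ => MeasurableSet.iInter fun i =>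
      (continuous_abs.measurable.comp (measurable_stepRate h p k i s)) measurableSet_Iic
  set f : Ω → ℝ := ({ω | S ((σ ω).untopA + w) ω = j ∧
    N ((σ ω).untopA + w) ω = N (σ ω).untopA ω}).indicator (fun _ => (1 : ℝ)) with hf
  have hfE : ∀ ω ∈ E, f ω = if N (arrival N p ω + (s + w)) ω = p ∧
      S (arrival N p ω + (s + w)) ω = j then 1 else 0 := by
    intro ω hω
    have h1 : (σ ω).untopA = arrival N p ω + s := untopA_timeAfter ⟨_, hω.1.ge⟩ s
    simp only [hf, Set.indicator_apply, Set.mem_ofPred_eq, h1, hω.1, ← add_assoc]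
    exact if_congr and_comm rfl rfl
  have hfm : Measurable f := by
    have hr : Measurable fun ω => (σ ω).untopA := (stoppingTime_history h p s).measurable'.untopA
    refine measurable_const.indicator (MeasurableSet.inter
      (measurable_chain_comp h (hr.add_const w) (measurableSet_singleton j)) ?_)
    exact measurableSet_eq_fun (measurable_counting_comp h (hr.add_const w))
      (measurable_counting_comp h hr)
  have hfi : Integrable f P := by
    refine Integrable.of_bound hfm.aestronglyMeasurable 1 (Eventually.of_forall fun ω => ?_)
    simp only [hf, Set.indicator_apply]
    exact abs_ite_one_zero_le _
  have hEΩ : MeasurableSet E := hmΩ _ hEm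
  set G : Ω → ℝ := fun ω => Φ ω (S (arrival N p ω + s) ω) j with hG
  have hGm : Measurable G := (measurable_apply_chain h hΦ.meas s j).mono (jointAt_le h p s) le_rfl
  have hGi : Integrable (E.indicator G) P := by
    refine Integrable.of_bound (hGm.indicator hEΩ).aestronglyMeasurable C
      (Eventually.of_forall fun ω => ?_)
    by_cases hω : ω ∈ E
    · rw [Set.indicator_of_mem hω]
      exact hbd ω hω.2 _ _
    · rw [Set.indicator_of_notMem hω, norm_zero]
      exact hC
  have hGmm : Measurable[stateHistAt h p s] (E.indicator G) := by
    have h1 : E.indicator G = E.indicator fun ω =>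
        ∑ i, (if stoppedValue S σ ω = i then (1 : ℝ) else 0) * Φ ω i j := by
      refine Set.indicator_congr fun ω hω => ?_
      have h1 : (σ ω).untopA = arrival N p ω + s := untopA_timeAfter ⟨_, hω.1.ge⟩ s
      simp [hG, stoppedValue, h1]
    rw [h1]
    refine Measurable.indicator (Finset.measurable_sum _ fun i _ => Measurable.mul ?_ ?_) hEm
    · have h2 : Measurable[stateHistAt h p s] (stoppedValue S σ) :=
        measurable_iff_comap_le.2 le_sup_left
      exact (measurable_of_countable fun k : Fin M => if k = i then (1 : ℝ) else 0).comp h2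
    · exact (hΦ.meas i j).mono ((histAt_mono h p (zero_le : 0 ≤ s)).trans hhist) le_rfl
  have hce : E.indicator G =ᵐ[P] P[E.indicator f | stateHistAt h p s] := by
    refine ae_eq_condExp_of_forall_setIntegral_eq hmΩ (hfi.indicator hEΩ)
      (fun _ _ _ => hGi.integrableOn) (fun B hB _ => ?_)
      hGmm.stronglyMeasurable.aestronglyMeasurable
    have hBE : MeasurableSet[stateHistAt h p s] (B ∩ E) := hB.inter hEm
    have hX := hΦ.integral_eq ((B ∩ E).indicator fun _ => 1)
      (measurable_const.indicator (hmj _ hBE)) 1 (fun ω => ?_) (fun ω hω => ?_) j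
    · rw [setIntegral_indicator hEΩ, setIntegral_indicator hEΩ, ← integral_indicator (hmΩ _ hBE),
        ← integral_indicator (hmΩ _ hBE)]
      calc _ = ∫ ω, (B ∩ E).indicator (fun _ => 1) ω * Φ ω (S (arrival N p ω + s) ω) j ∂P := by
            refine integral_congr_ae (Eventually.of_forall fun ω => ?_)
            by_cases hω : ω ∈ B ∩ E <;> simp [hω, hG]
        _ = _ := hX.symm
        _ = _ := by
            refine integral_congr_ae (Eventually.of_forall fun ω => ?_)
            by_cases hω : ω ∈ B ∩ E
            · simp only [Set.indicator_of_mem hω, one_mul, hfE ω hω.2]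
            · simp only [Set.indicator_of_notMem hω, zero_mul]
    · by_cases hω : ω ∈ B ∩ E <;> simp [hω]
    · exact Set.indicator_of_notMem (fun h1 => hω h1.2) _
  have hci := condExp_indicator (m := stateHistAt h p s) hfi hEm
  filter_upwards [hce, hci] with ω h1 h2 hNω hKω
  have hω : ω ∈ E := ⟨hNω, hKω⟩
  rw [h2, Set.indicator_of_mem hω, Set.indicator_of_mem hω] at h1
  exact h1.symm

lemma ae_noEventTransition_eq (h : IsMMHPDelta P Q μ φ δ S N) (p : ℕ) {L : ℕ}
    {s w : ℝ≥0} {Φ : Ω → Matrix (Fin M) (Fin M) ℝ}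
    (hΦ : ∀ K : ℝ, 0 ≤ K → IsTransition h p (rateBdd μ φ δ N p L K) s (s + w) Φ) (j : Fin M) :
    ∀ᵐ ω ∂P, N (arrival N p ω + s) ω = p →
      noEventTransition P S N h.measurable_counting (stoppingTime_history h p s) w j ω
        = Φ ω (S (arrival N p ω + s) ω) j := by
  have hall := ae_all_iff.2 fun K : ℕ =>
    ae_noEventTransition_eq_of_mem h p (hΦ K K.cast_nonneg) j
  filter_upwards [hall] with ω hω hNω
  -- finitely many rates are bounded
  set B : ℝ := ∑ k ∈ Finset.range (L + 1), ∑ i, |stepRate μ φ δ N p k i ω| with hB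
  refine hω ⌈B⌉₊ hNω fun k hk i => le_trans ?_ (Nat.le_ceil B)
  calc |stepRate μ φ δ N p k i ω| ≤ ∑ i, |stepRate μ φ δ N p k i ω| :=
        Finset.single_le_sum (f := fun i => |stepRate μ φ δ N p k i ω|)
          (fun _ _ => abs_nonneg _) (Finset.mem_univ i)
    _ ≤ B := Finset.single_le_sum (f := fun k => ∑ i, |stepRate μ φ δ N p k i ω|)
          (fun _ _ => Finset.sum_nonneg fun _ _ => abs_nonneg _)
          (Finset.mem_range.2 (Nat.lt_succ_of_le hk))

end ConditionalProbability
end MMHP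

theorem mainTheorem1 {Ω : Type*} [MeasurableSpace Ω] (P : Measure Ω) [IsProbabilityMeasure P]
    {M : ℕ} (Q : Matrix (Fin M) (Fin M) ℝ) (μ : Fin M → ℝ) (φ : Fin M → ℝ → ℝ) (δ : ℝ)
    (S : ℝ≥0 → Ω → Fin M) (N : ℝ≥0 → Ω → ℕ) (h : MMHP.IsMMHPDelta P Q μ φ δ S N)
    (n : ℕ) (hn : 1 ≤ n) :
    (∀ (u : ℝ≥0) (i j : Fin M), ∀ᵐ ω ∂P,
      MMHP.timeAfter N n 0 ω ≠ ⊤ →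
      stoppedValue S (MMHP.timeAfter N n 0) ω = i →
        MMHP.forwardTransition h n u j ω
          = MMHP.forwardFormula Q (fun k => MMHP.stepLambda μ φ δ N n k ω) δ u i j) ∧
    (∀ (x u : ℝ≥0), 0 < x → u ≤ x → ∀ i j : Fin M, ∀ᵐ ω ∂P,
      MMHP.timeAfter N n (x - u) ω ≠ ⊤ →
      stoppedValue N (MMHP.timeAfter N n (x - u)) ω = n - 1 →
      stoppedValue S (MMHP.timeAfter N n (x - u)) ω = i →
        MMHP.backwardTransition h n x u j ω
          = MMHP.backwardFormula Q (fun k => MMHP.stepLambda μ φ δ N n k ω) δ x u i j) := by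
  obtain ⟨p, rfl⟩ : ∃ p, n = p + 1 := ⟨n - 1, by omega⟩
  refine ⟨fun u i j => ?_, fun x u hx hu i j => ?_⟩
  · have hT : ∀ K : ℝ, 0 ≤ K → MMHP.IsTransition h p _ 0 (0 + u) _ := fun K hK => by
      rw [zero_add]
      exact MMHP.isTransition_forwardFormula h p u hK
    filter_upwards [MMHP.ae_noEventTransition_eq h p hT j] with ω hω htop hS
    have hreach := (MMHP.timeAfter_ne_top_iff (N := N) 0).1 htop
    rw [stoppedValue, MMHP.untopA_timeAfter hreach] at hS
    rw [← hS]
    refine hω ?_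
    rw [add_zero, h.counting.apply_arrival hreach]
  · have hT : ∀ K : ℝ, 0 ≤ K → MMHP.IsTransition h p _ (x - u) (x - u + u) _ := fun K hK => by
      rw [tsub_add_cancel_of_le hu]
      exact MMHP.isTransition_backwardFormula h p hx hu hK
    filter_upwards [MMHP.ae_noEventTransition_eq h p hT j] with ω hω htop hN hS
    have hreach := (MMHP.timeAfter_ne_top_iff (N := N) (x - u)).1 htop
    rw [stoppedValue, MMHP.untopA_timeAfter hreach] at hS hN
    rw [← hS]
    exact hω hN
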